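/- Let $h(z_0,z_1,z_2)=-\operatorname{Re}(z_0\overline{z_2})+|z_1|^2$ be the Hermitian form of signature $(1,2)$ on $\mathbb C^3$ with matrix $I_{1,2}$, and let $\operatorname{PU}(1,2)$ and $\operatorname{PO}(1,2)$ be the images in $\operatorname{PGL}_3(\mathbb C)$ of the group $\operatorname{U}(1,2)=\{X\in \operatorname{GL}_3(\mathbb C): X^*I_{1,2}X=I_{1,2}\}$ and of its subgroup of real matrices. Let $K\subset\mathbb C$ be an imaginary quadratic number field with ring of integers $\mathcal O_K$ and discriminant $D_K$, with trace $\operatorname{Tr}$ and norm $N$ over $\mathbb Q$, and let $\Gamma_K=\operatorname{PU}(1,2)\cap\operatorname{PGL}_3(\mathcal O_K)$ be the Picard modular group. For $\Delta\in\mathcal O_K\setminus\{0\}$ let $$Y_\Delta=\begin{pmatrix}0&0&1/\overline\Delta\\0&1&0\\\Delta&0&0\end{pmatrix},\qquad \Gamma_{K,\Delta}=\{[X]\in\Gamma_K:\ [X\,Y_\Delta\,\overline X^{\,-1}]=[Y_\Delta]\}.$$ For nonzero integers $a,b$ let $\mathcal Q=\left(\frac{a,b}{\mathbb Q}\right)$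 be the quaternion algebra with generators $i,j,k$, $i^2=a$, $j^2=b$, $ij=-ji=k$; write $\mathcal Q(\mathbb R)=\mathcal Q\otimes_{\mathbb Q}\mathbb R$, $\mathcal Q(\mathbb Z)=\mathbb Z+\mathbb Zi+\mathbb Zj+\mathbb Zk$, and denote by an exponent $1$ the group of elements of reduced norm $1$. A subgroup $\Gamma$ of $\operatorname{PU}(1,2)$ *arises from* $\mathcal Q$ if $\mathcal Q(\mathbb R)\simeq\mathcal M_2(\mathbb R)$ and there are a conjugate $H$ of $\operatorname{PO}(1,2)$ in $\operatorname{PU}(1,2)$ containing $\Gamma$ and a Lie group epimorphism $\varphi$ from $\mathcal Q(\mathbb R)^1$ onto the identity component of $H$, with kernel the centre of $\mathcal Q(\mathbb R)^1$, such that $\Gamma$ and $\varphi(\mathcal Q(\mathbb Z)^1)$ are commensurable (their intersection has finite index in both). **Theorem.** For every $\Delta\in\mathcal O_K\setminus\{0\}$, the group $\Gamma_{K,\Delta}$ arises from $\left(\frac{2\operatorname{Tr}\Delta,\;N(\Delta)\,|D_K|}{\mathbb Q}\right)$ if $\operatorname{Tr}\Delta\neq0$, and from $\left(\frac{1,\,1}{\mathbb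 Q}\right)\simeq\mathcal M_2(\mathbb Q)$ if $\operatorname{Tr}\Delta=0$. -/

import Mathlib

open scoped Matrix MatrixGroups Quaternion NumberField

/-! ### The projective unitary group of signature (1,2) -/

/-- The quotient topology on `PGL₃(ℂ) = GL₃(ℂ)/ℂˣ`. -/
noncomputable instance pgl3Topology : TopologicalSpace PGL(3, ℂ) :=
  TopologicalSpace.coinduced (Matrix.ProjGenLinGroup.mk : GL (Fin 3) ℂ →* PGL(3, ℂ)) inferInstance

/-- The matrix of the Hermitian form `h(z) = -Re(z₀ z̄₂) + |z₁|²`, that is `h(z) = z* I₁₂ z`. -/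
noncomputable def hermMatrix : Matrix (Fin 3) (Fin 3) ℂ :=
  !![0, 0, -1/2; 0, 1, 0; -1/2, 0, 0]

/-- The unitary group `U(1,2)` of `h`: invertible complex matrices `X` with `X* I₁₂ X = I₁₂`. -/
def U12 : Subgroup (GL (Fin 3) ℂ) where
  carrier := {X | (X : Matrix (Fin 3) (Fin 3) ℂ)ᴴ * hermMatrix * (X : Matrix (Fin 3) (Fin 3) ℂ)
    = hermMatrix}
  one_mem' := by simp
  mul_mem' := by
    intro X Y hX hY
    simp only [Set.mem_ofPred_eq] at hX hY ⊢
    calc _ = (Y : Matrix (Fin 3) (Fin 3) ℂ)ᴴ * ((X : Matrix (Fin 3) (Fin 3) ℂ)ᴴ * hermMatrix *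
            (X : Matrix (Fin 3) (Fin 3) ℂ)) * (Y : Matrix (Fin 3) (Fin 3) ℂ) := by
          simp [Matrix.conjTranspose_mul, Matrix.mul_assoc]
      _ = _ := by rw [hX, hY]
  inv_mem' := by
    intro X hX
    simp only [Set.mem_ofPred_eq] at hX ⊢
    have h1 : (X : Matrix (Fin 3) (Fin 3) ℂ) * ((X⁻¹ : GL (Fin 3) ℂ) : Matrix (Fin 3) (Fin 3) ℂ)
        = 1 := X.mul_inv
    have h2 : ((X⁻¹ : GL (Fin 3) ℂ) : Matrix (Fin 3) (Fin 3) ℂ)ᴴ *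
        (X : Matrix (Fin 3) (Fin 3) ℂ)ᴴ = 1 := by
      rw [← Matrix.conjTranspose_mul, h1, Matrix.conjTranspose_one]
    generalize ((X⁻¹ : GL (Fin 3) ℂ) : Matrix (Fin 3) (Fin 3) ℂ) = Z at *
    calc Zᴴ * hermMatrix * Z = Zᴴ * ((X : Matrix (Fin 3) (Fin 3) ℂ)ᴴ * hermMatrix *
            (X : Matrix (Fin 3) (Fin 3) ℂ)) * Z := by rw [hX]
      _ = (Zᴴ * (X : Matrix (Fin 3) (Fin 3) ℂ)ᴴ) * hermMatrix *
            ((X : Matrix (Fin 3) (Fin 3) ℂ) * Z) := by simp only [Matrix.mul_assoc]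
      _ = hermMatrix := by rw [h1, h2, Matrix.one_mul, Matrix.mul_one]

/-- `PU(1,2)`, the image of `U(1,2)` in `PGL₃(ℂ)`; the kernel of `U(1,2) → PGL₃(ℂ)` is the group
`U(1)` of scalars of modulus one. -/
def PU12 : Subgroup PGL(3, ℂ) := U12.map Matrix.ProjGenLinGroup.mk

/-- `PO(1,2)`, the image in `PGL₃(ℂ)` of `O(1,2)`, the group of real matrices in `U(1,2)`. -/
noncomputable def PO12 : Subgroup PGL(3, ℂ) :=
  (U12 ⊓ (Matrix.GeneralLinearGroup.map (n := Fin 3) Complex.ofRealHom).range).map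
    Matrix.ProjGenLinGroup.mk

/-- The conjugate `g PO(1,2) g⁻¹`. -/
noncomputable def conjPO12 (g : PGL(3, ℂ)) : Subgroup PGL(3, ℂ) :=
  PO12.map (MulAut.conj g).toMonoidHom

/-- The identity component of a subgroup of `PGL₃(ℂ)` (as a set), for the induced topology. -/
def identityComponent (H : Subgroup PGL(3, ℂ)) : Set PGL(3, ℂ) :=
  connectedComponentIn (H : Set PGL(3, ℂ)) 1

/-! ### The Picard modular group and the stabiliser of `[Y_Δ]` -/

/-- The Picard modular group `Γ_K = PU(1,2) ∩ PGL₃(𝒪_K)`, where `K` is regarded as a subfield of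
`ℂ` through `σ`. -/
noncomputable def picardGroup (K : Type*) [Field K] [NumberField K] (σ : K →+* ℂ) :
    Subgroup PGL(3, ℂ) :=
  PU12 ⊓ (Matrix.ProjGenLinGroup.map (n := Fin 3) (σ.comp (algebraMap (𝓞 K) K))).range

/-- The matrix `Y_D = (0, 0, 1/D̄; 0, 1, 0; D, 0, 0)` for `D ∈ ℂˣ`; its inverse is its complex
conjugate. -/
noncomputable def YMatrix (D : ℂ) (hD : D ≠ 0) : GL (Fin 3) ℂ where
  val := !![0, 0, 1 / star D; 0, 1, 0; D, 0, 0]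
  inv := !![0, 0, 1 / D; 0, 1, 0; star D, 0, 0]
  val_inv := by
    have h : (starRingEnd ℂ) D ≠ 0 := by simpa using hD
    ext i j; fin_cases i <;> fin_cases j <;> simp [Matrix.mul_apply, Fin.sum_univ_three, hD]
  inv_val := by
    have h : (starRingEnd ℂ) D ≠ 0 := by simpa using hD
    ext i j; fin_cases i <;> fin_cases j <;> simp [Matrix.mul_apply, Fin.sum_univ_three, hD]

/-- Complex conjugation of the coefficients, on `PGL₃(ℂ)`. -/
noncomputable def pglConj : PGL(3, ℂ) →* PGL(3, ℂ) :=
  Matrix.ProjGenLinGroup.map (starRingEnd ℂ)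

/-- The stabiliser in the subgroup `Γ` of a point `y` for the action `(x, y) ↦ x y x̄⁻¹`. -/
noncomputable def twistedStabilizer (Γ : Subgroup PGL(3, ℂ)) (y : PGL(3, ℂ)) :
    Subgroup PGL(3, ℂ) where
  carrier := {x | x ∈ Γ ∧ x * y * (pglConj x)⁻¹ = y}
  one_mem' := ⟨Γ.one_mem, by simp⟩
  mul_mem' := by
    rintro x x' ⟨hx, h⟩ ⟨hx', h'⟩
    refine ⟨Γ.mul_mem hx hx', ?_⟩
    rw [map_mul, mul_inv_rev]
    calc _ = x * (x' * y * (pglConj x')⁻¹) * (pglConj x)⁻¹ := by simp only [mul_assoc]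
      _ = y := by rw [h', h]
  inv_mem' := by
    rintro x ⟨hx, h⟩
    refine ⟨Γ.inv_mem hx, ?_⟩
    rw [map_inv, inv_inv]
    nth_rewrite 1 [← h]
    group

/-- `Γ_{K,Δ}`: the stabiliser in the Picard modular group `Γ_K` of the class `[Y_Δ]`. -/
noncomputable def picardStabilizer (K : Type*) [Field K] [NumberField K] (σ : K →+* ℂ)
    (Δ : 𝓞 K) (hΔ : Δ ≠ 0) : Subgroup PGL(3, ℂ) :=
  twistedStabilizer (picardGroup K σ)
    (Matrix.ProjGenLinGroup.mk (YMatrix (σ (Δ : K)) (by simpa using hΔ)))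

/-! ### Quaternion algebras

For integers `a`, `b`, `ℍ[R, a, 0, b]` is the `R`-algebra with basis `1, i, j, k` and relations
`i² = a`, `j² = b`, `ij = -ji = k`; its `star` is the quaternion conjugation, so that
`unitary ℍ[R, a, 0, b]` is the group `𝒬(R)¹` of elements of reduced norm `x x̄ = 1`. -/

/-- The topology of `𝒬(ℝ)` as a four-dimensional real vector space. -/
noncomputable instance quaternionTopology (a b : ℝ) : TopologicalSpace ℍ[ℝ, a, 0, b] :=
  TopologicalSpace.induced (QuaternionAlgebra.equivTuple a 0 b) inferInstance

/-- `𝒬(ℤ)¹` as a subgroup of `𝒬(ℝ)¹`: the elements of `ℤ + ℤi + ℤj + ℤk` of reduced norm one. -/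
def integralNormOne (a b : ℤ) : Subgroup (unitary ℍ[ℝ, (a : ℝ), 0, (b : ℝ)]) where
  carrier := {x | ∃ y : ℍ[ℤ, a, 0, b],
    (x : ℍ[ℝ, (a : ℝ), 0, (b : ℝ)]) = ⟨y.re, y.imI, y.imJ, y.imK⟩}
  one_mem' := ⟨1, by ext <;> simp⟩
  mul_mem' := by
    rintro x x' ⟨y, hy⟩ ⟨y', hy'⟩
    refine ⟨y * y', ?_⟩
    rw [Submonoid.coe_mul, hy, hy']
    ext <;> simp
  inv_mem' := by
    rintro x ⟨y, hy⟩
    refine ⟨star y, ?_⟩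
    rw [← Unitary.star_eq_inv, Unitary.coe_star, hy]
    ext <;> simp

/-- The subgroup `Γ` of `PU(1,2)` arises from the quaternion algebra `𝒬 = (a, b / ℚ)`: `𝒬` splits
over `ℝ`, and there is a Lie group epimorphism `φ` from `𝒬(ℝ)¹` onto the identity component of a
conjugate of `PO(1,2)` containing `Γ`, whose kernel is the centre of `𝒬(ℝ)¹`, such that `Γ` and
`φ(𝒬(ℤ)¹)` are commensurable. (A homomorphism of Lie groups is a continuous group homomorphism, and
the identity component is used since `𝒬(ℝ)¹ ≃ SL₂(ℝ)` is connected while `PO(1,2)` is not.) -/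
def ArisesFrom (Γ : Subgroup PGL(3, ℂ)) (a b : ℤ) : Prop :=
  Nonempty (ℍ[ℝ, (a : ℝ), 0, (b : ℝ)] ≃ₐ[ℝ] Matrix (Fin 2) (Fin 2) ℝ) ∧
  ∃ g ∈ PU12, Γ ≤ conjPO12 g ∧
    ∃ φ : unitary ℍ[ℝ, (a : ℝ), 0, (b : ℝ)] →* PGL(3, ℂ),
      Continuous φ ∧
      Set.range φ = identityComponent (conjPO12 g) ∧
      φ.ker = Subgroup.center (unitary ℍ[ℝ, (a : ℝ), 0, (b : ℝ)]) ∧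
      Subgroup.Commensurable Γ ((integralNormOne a b).map φ)

/-! ### The conjugation action of a quaternion algebra on its pure quaternions -/

/-! Since `Y_Δ` times its complex conjugate is 1, `z ↦ Y_Δ z̄` is an antiholomorphic involution of
`ℂ³`. Its fixed points are the vectors `(z₀, t, Δ z̄₀)` with `t` real, a real form `V` of `ℂ³`. A
class in `PU(1,2)` fixing `[Y_Δ]` has a representative commuting with the involution, hence acts on
`V` as an isometry of `h|V = -Re(Δ̄ z₀²) + t²`. The stabiliser therefore lies in a conjugate of
`PO(1,2)`.

The quaternion algebra appears because `V` has a basis with coordinates in `𝒪_K`, the columns of a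
matrix `Q`, in which `h` is a positive multiple of `diag(a, b, -ab)`, the form `v ↦ v²` on the pure
quaternions of `(a, b)`. Quaternions of norm one act on these by `v ↦ x v x̄`, and over `ℝ` this
gives the identity component modulo the centre (`range_frameHom_conjGL_eq_identityComponent`,
`ker_frameHom_conjGL`). `arisesFrom_of_frame` deduces the theorem from such a basis; only the choice
of `Q` depends on whether the trace of `Δ` vanishes.

Commensurability is proved by congruence subgroups, in two directions. An integral quaternion acting
trivially modulo `N(det Q)` stays integral after conjugation by `Q` (`relIndex_integral_ne_zero`).
Conversely, let `X` in the stabiliser be congruent to 1 modulo a suitable `M`. The congruence kills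
all ambiguity by units and scalars, so `X` has determinant one and commutes with the involution.
Then `Q⁻¹XQ` is a rational integral rotation congruent to 1 modulo `16ab`
(`relIndex_stabilizer_ne_zero`), and `exists_conjMatrix_eq_of_congruence` lifts it to an integral
quaternion of norm one. -/

namespace QuaternionAlgebra

section CommRing

variable {R : Type*} [CommRing R] {a b : R}

/-- The reduced norm of a quaternion. -/
def reducedNorm (x : ℍ[R, a, 0, b]) : R :=
  x.re ^ 2 - a * x.imI ^ 2 - b * x.imJ ^ 2 + a * b * x.imK ^ 2

/-- The matrix of `v ↦ x v x̄` on the pure quaternions, in the basis `i, j, k`. -/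
def conjMatrix (x : ℍ[R, a, 0, b]) : Matrix (Fin 3) (Fin 3) R :=
  !![x.re ^ 2 - a * x.imI ^ 2 + b * x.imJ ^ 2 - a * b * x.imK ^ 2,
      2 * b * (x.re * x.imK - x.imI * x.imJ), 2 * b * (a * x.imI * x.imK - x.re * x.imJ);
    -2 * a * (x.re * x.imK + x.imI * x.imJ),
      x.re ^ 2 + a * x.imI ^ 2 - b * x.imJ ^ 2 - a * b * x.imK ^ 2,
      2 * a * (b * x.imJ * x.imK + x.re * x.imI);
    -2 * (a * x.imI * x.imK + x.re * x.imJ), 2 * (x.re * x.imI - b * x.imJ * x.imK)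
      , x.re ^ 2 + a * x.imI ^ 2 + b * x.imJ ^ 2 + a * b * x.imK ^ 2]

/-- The Gram matrix of the quadratic form `v ↦ v²` on the pure quaternions. -/
def pureGram (a b : R) : Matrix (Fin 3) (Fin 3) R :=
  !![a, 0, 0; 0, b, 0; 0, 0, -(a * b)]

theorem self_mul_star_eq_reducedNorm (x : ℍ[R, a, 0, b]) : x * star x = (reducedNorm x : R) := by
  rw [mul_star_eq_coe, coe_inj]
  simp [reducedNorm]
  ring

theorem star_mul_self_eq_reducedNorm (x : ℍ[R, a, 0, b]) : star x * x = (reducedNorm x : R) := by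
  rw [star_mul_eq_coe, coe_inj]
  simp [reducedNorm]
  ring

theorem mem_unitary_iff_reducedNorm {x : ℍ[R, a, 0, b]} :
    x ∈ unitary ℍ[R, a, 0, b] ↔ reducedNorm x = 1 := by
  rw [Unitary.mem_iff, self_mul_star_eq_reducedNorm, star_mul_self_eq_reducedNorm, and_self,
    ← coe_one, coe_inj]

theorem conjMatrix_one : conjMatrix (1 : ℍ[R, a, 0, b]) = 1 := by
  ext r s; fin_cases r <;> fin_cases s <;> simp [conjMatrix]

theorem conjMatrix_mul (x y : ℍ[R, a, 0, b]) :
    conjMatrix (x * y) = conjMatrix x * conjMatrix y := by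
  ext r s
  fin_cases r <;> fin_cases s <;> simp [conjMatrix, Matrix.mul_apply, Fin.sum_univ_three] <;> ring

theorem conjMatrix_transpose_mul_pureGram_mul (x : ℍ[R, a, 0, b]) :
    (conjMatrix x)ᵀ * pureGram a b * conjMatrix x = reducedNorm x ^ 2 • pureGram a b := by
  ext r s
  fin_cases r <;> fin_cases s <;>
    simp [conjMatrix, pureGram, reducedNorm, Matrix.mul_apply, Fin.sum_univ_three] <;> ring

theorem det_conjMatrix (x : ℍ[R, a, 0, b]) : (conjMatrix x).det = reducedNorm x ^ 3 := by
  simp [Matrix.det_fin_three, conjMatrix, reducedNorm]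
  ring

theorem conjMatrix_map {S : Type*} [CommRing S] (f : R →+* S) (x : ℍ[R, a, 0, b]) :
    (conjMatrix x).map f =
      conjMatrix (⟨f x.re, f x.imI, f x.imJ, f x.imK⟩ : ℍ[S, f a, 0, f b]) := by
  ext r s
  fin_cases r <;> fin_cases s <;> simp [conjMatrix, map_ofNat]

theorem conjMatrix_smul (c : R) (x : ℍ[R, a, 0, b]) :
    conjMatrix (c • x) = c ^ 2 • conjMatrix x := by
  ext r s
  fin_cases r <;> fin_cases s <;> simp [conjMatrix] <;> ring

theorem reducedNorm_smul (c : R) (x : ℍ[R, a, 0, b]) :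
    reducedNorm (c • x) = c ^ 2 * reducedNorm x := by
  simp [reducedNorm]; ring

end CommRing

/-! ### Lifting a rotation of the pure quaternions to a quaternion -/

section Field

variable {F : Type*} [Field F] {a b : F}

/-- For a rotation `A` of the pure quaternions, this is `∑ A(e) e⁻¹`, where `e` runs over the basis
`1, i, j, k`; conjugation by this element is `A`. -/
def rotationLift (a b : F) (A : Matrix (Fin 3) (Fin 3) F) : ℍ[F, a, 0, b] :=
  ⟨1 + A 0 0 + A 1 1 + A 2 2, A 2 1 + A 1 2 / a, -(A 2 0 + A 0 2 / b), A 0 1 / b - A 1 0 / a⟩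

theorem pureGram_mul_adjugate (A : Matrix (Fin 3) (Fin 3) F)
    (hA : Aᵀ * pureGram a b * A = pureGram a b) (hdet : A.det = 1) :
    pureGram a b * A.adjugate = Aᵀ * pureGram a b := by
  nth_rewrite 1 [← hA]
  rw [Matrix.mul_assoc _ A, Matrix.mul_adjugate, hdet, one_smul, Matrix.mul_one]

/-- If `A` is conjugation by `x` of norm one, then `∑ x e x̄ e⁻¹ = x ∑ e x̄ e⁻¹ = 4 x₀ x`, which
explains both formulas. The proof does not presuppose such an `x`: both are polynomial consequences
of the orthogonality of the columns of `A` (`hA`), that of its rows (`hdual`), and the equality of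
cofactors with entries up to the Gram matrix (`hadj`). They remain true, but empty, when the lift
vanishes. -/
theorem reducedNorm_and_conjMatrix_rotationLift (ha : a ≠ 0) (hb : b ≠ 0)
    (A : Matrix (Fin 3) (Fin 3) F) (hA : Aᵀ * pureGram a b * A = pureGram a b)
    (hdet : A.det = 1) :
    reducedNorm (rotationLift a b A) = 4 * (rotationLift a b A).re ∧
      conjMatrix (rotationLift a b A) = (4 * (rotationLift a b A).re) • A := by
  have hadj := pureGram_mul_adjugate A hA hdet
  have hdual : (a * b) • (A * !![b, 0, 0; 0, a, 0; 0, 0, -1] * Aᵀ) =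
      (a * b) • !![b, 0, 0; 0, a, 0; 0, 0, -1] := by
    have hG : !![b, 0, 0; 0, a, 0; 0, 0, -1] * pureGram a b = (a * b) • 1 := by
      ext r s
      fin_cases r <;> fin_cases s <;>
        simp [pureGram, Matrix.mul_apply, Fin.sum_univ_three, mul_comm]
    have hG' : pureGram a b * !![b, 0, 0; 0, a, 0; 0, 0, -1] = (a * b) • 1 := by
      ext r s
      fin_cases r <;> fin_cases s <;>
        simp [pureGram, Matrix.mul_apply, Fin.sum_univ_three, mul_comm]
    have hAA : A * A.adjugate = 1 := by rw [Matrix.mul_adjugate, hdet, one_smul]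
    calc (a * b) • (A * !![b, 0, 0; 0, a, 0; 0, 0, -1] * Aᵀ)
        = A * !![b, 0, 0; 0, a, 0; 0, 0, -1] * Aᵀ * ((a * b) • 1) := by simp
      _ = A * !![b, 0, 0; 0, a, 0; 0, 0, -1] * (Aᵀ * pureGram a b) *
            !![b, 0, 0; 0, a, 0; 0, 0, -1] := by rw [← hG']; simp only [Matrix.mul_assoc]
      _ = A * (!![b, 0, 0; 0, a, 0; 0, 0, -1] * pureGram a b) * A.adjugate *
            !![b, 0, 0; 0, a, 0; 0, 0, -1] := by rw [← hadj]; simp only [Matrix.mul_assoc]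
      _ = _ := by rw [hG]; simp [hAA]
  have hdual' := smul_right_injective _ (mul_ne_zero ha hb) hdual
  have hc := fun r s => congrFun (congrFun hadj r) s
  have ho := fun r s => congrFun (congrFun hA r) s
  have hd := fun r s => congrFun (congrFun hdual' r) s
  have c00 := hc 0 0
  have c01 := hc 0 1
  have c02 := hc 0 2
  have c10 := hc 1 0
  have c11 := hc 1 1
  have c12 := hc 1 2
  have c20 := hc 2 0
  have c21 := hc 2 1
  have c22 := hc 2 2
  have o00 := ho 0 0
  have o01 := ho 0 1
  have o02 := ho 0 2
  have o11 := ho 1 1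
  have o12 := ho 1 2
  have o22 := ho 2 2
  have d00 := hd 0 0
  have d01 := hd 0 1
  have d02 := hd 0 2
  have d11 := hd 1 1
  have d12 := hd 1 2
  have d22 := hd 2 2
  clear hc ho hd hdual hdual' hadj hA hdet
  simp [pureGram, Matrix.mul_apply, Fin.sum_univ_three, Matrix.adjugate_fin_three] at c00 c01 c02 c10 c11 c12 c20 c21 c22 o00 o01 o02 o11 o12 o22 d00 d01 d02 d11 d12 d22
  constructor
  · simp only [reducedNorm, rotationLift]
    generalize A 0 0 = A00, A 0 1 = A01, A 0 2 = A02, A 1 0 = A10, A 1 1 = A11, A 1 2 = A12,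
      A 2 0 = A20, A 2 1 = A21, A 2 2 = A22 at *
    field_simp
    grind
  · ext r s
    fin_cases r <;> fin_cases s <;> simp [conjMatrix, rotationLift] <;>
    generalize A 0 0 = A00, A 0 1 = A01, A 0 2 = A02, A 1 0 = A10, A 1 1 = A11, A 1 2 = A12,
      A 2 0 = A20, A 2 1 = A21, A 2 2 = A22 at * <;>
    field_simp <;>
    grind

end Field

end QuaternionAlgebra

/-! ### Integral rotations near the identity lift to integral quaternions -/

namespace QuaternionAlgebra

/-- A symmetric integral matrix of rank one with first entry `y` and first row `w`, whose other
diagonal entries are `z`, is `d s sᵀ` with `d` squarefree and `s` integral. -/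
theorem exists_squarefree_mul_of_mul_eq_sq {ι : Type*} (y : ℤ) (hy : y ≠ 0) (w z : ι → ℤ)
    (h : ∀ i, y * z i = w i ^ 2) :
    ∃ (d s₀ : ℤ) (s : ι → ℤ), y = d * s₀ ^ 2 ∧ (∀ i, w i = d * s₀ * s i) ∧
      ∀ i, z i = d * s i ^ 2 := by
  obtain ⟨d, s₀, hds, hd⟩ : ∃ d s₀ : ℤ, d * s₀ ^ 2 = y ∧ Squarefree d := by
    obtain ⟨e, t, het, he⟩ := Nat.sq_mul_squarefree y.natAbs
    have he' : Squarefree (e : ℤ) := Int.squarefree_natCast.mpr he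
    have hy' : (t : ℤ) ^ 2 * e = |y| := by rw [Int.abs_eq_natAbs]; exact_mod_cast het
    rcases abs_choice y with hc | hc
    · exact ⟨e, t, by rw [← hc, ← hy']; ring, he'⟩
    · exact ⟨-e, t, by linarith, fun x hx => he' x ((dvd_neg).mp hx)⟩
  have hs₀ : s₀ ≠ 0 := by rintro rfl; simp at hds; exact hy hds.symm
  have hd₀ : d ≠ 0 := hd.ne_zero
  have key : ∀ i, ∃ t, w i = d * s₀ * t := fun i => by
    have h1 : s₀ ^ 2 ∣ w i ^ 2 := ⟨d * z i, by rw [← h, ← hds]; ring⟩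
    obtain ⟨t, ht⟩ := (Int.pow_dvd_pow_iff two_ne_zero).mp h1
    have h2 : d * z i = t ^ 2 := by
      have := h i
      rw [← hds, ht] at this
      exact mul_left_cancel₀ (pow_ne_zero 2 hs₀) (by linarith)
    -- Here `d` divides `t²`, and being squarefree it divides `t`.
    obtain ⟨t', rfl⟩ := (hd.dvd_pow_iff_dvd two_ne_zero).mp ⟨z i, h2.symm⟩
    exact ⟨t', by rw [ht]; ring⟩
  choose s hs using key
  refine ⟨d, s₀, s, hds.symm, hs, fun i => ?_⟩
  have := h i
  rw [hs, ← hds] at this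
  exact mul_left_cancel₀ (mul_ne_zero hd₀ (pow_ne_zero 2 hs₀)) (by linarith)

/-- An integral rotation of the pure quaternions that is congruent to the identity modulo `16ab` is
the conjugation by an integral quaternion of reduced norm one. -/
theorem exists_conjMatrix_eq_of_congruence {a b : ℤ} (ha : a ≠ 0) (hb : b ≠ 0)
    (E : Matrix (Fin 3) (Fin 3) ℤ)
    (hA : (1 + (16 * a * b) • E)ᵀ * pureGram a b * (1 + (16 * a * b) • E) = pureGram a b)
    (hdet : (1 + (16 * a * b) • E).det = 1) :
    ∃ x : ℍ[ℤ, a, 0, b], reducedNorm x = 1 ∧ conjMatrix x = 1 + (16 * a * b) • E := by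
  set A := 1 + (16 * a * b) • E with hAdef
  have haq : (a : ℚ) ≠ 0 := by exact_mod_cast ha
  have hbq : (b : ℚ) ≠ 0 := by exact_mod_cast hb
  have hAq : (A.map (Int.castRingHom ℚ))ᵀ * pureGram (a : ℚ) b * A.map (Int.castRingHom ℚ) =
      pureGram (a : ℚ) b := by
    have hG : pureGram (a : ℚ) b = (pureGram a b).map (Int.castRingHom ℚ) := by
      ext r s; fin_cases r <;> fin_cases s <;> simp [pureGram]
    rw [hG, ← Matrix.transpose_map, ← Matrix.map_mul, ← Matrix.map_mul, hA]
  have hdetq : (A.map (Int.castRingHom ℚ)).det = 1 := by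
    rw [← RingHom.mapMatrix_apply, ← RingHom.map_det, hdet, map_one]
  obtain ⟨hn, hc⟩ := reducedNorm_and_conjMatrix_rotationLift haq hbq _ hAq hdetq
  have hA' : ∀ r s, A r s = (1 : Matrix (Fin 3) (Fin 3) ℤ) r s + 16 * a * b * E r s := fun r s => by
    rw [hAdef, Matrix.add_apply, Matrix.smul_apply, smul_eq_mul]
  set u := rotationLift (a : ℚ) b (A.map (Int.castRingHom ℚ)) with hu
  -- the entries of the rank one matrix `u uᵀ / 4 u₀`
  let y : ℤ := 1 + 4 * a * b * (E 0 0 + E 1 1 + E 2 2)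
  let w : Fin 3 → ℤ := ![4 * a * b * E 2 1 + 4 * b * E 1 2, -(4 * a * b * E 2 0 + 4 * a * E 0 2),
    4 * a * E 0 1 - 4 * b * E 1 0]
  let z : Fin 3 → ℤ := ![-(4 * b * (E 0 0 - E 1 1 - E 2 2)), -(4 * a * (E 1 1 - E 0 0 - E 2 2)),
    4 * (E 2 2 - E 0 0 - E 1 1)]
  -- The factor `ab` of the modulus absorbs the denominators of `rotationLift`. The factor 16
  -- leaves, after division by 4, integers `y` and `w` with `y ≡ 1` modulo 4.
  have hu0 : u.re = 4 * y := by
    simp [hu, rotationLift, hA', y]; ring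
  have hu1 : u.imI = 4 * w 0 := by
    simp [hu, rotationLift, hA', w]; field_simp; ring
  have hu2 : u.imJ = 4 * w 1 := by
    simp [hu, rotationLift, hA', w]; field_simp; ring
  have hu3 : u.imK = 4 * w 2 := by
    simp [hu, rotationLift, hA', w]; field_simp; ring
  have hy : y ≠ 0 := by
    intro h
    have : 4 * (a * b * (E 0 0 + E 1 1 + E 2 2)) = -1 := by simp only [y] at h; linarith
    omega
  have hentry := fun r s => congrFun (congrFun hc r) s
  have hz : ∀ i, y * z i = w i ^ 2 := by
    -- The norm of `u` together with the three diagonal entries of its conjugation matrix isolates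
    -- the square of each imaginary coordinate.
    have h00 := hentry 0 0
    have h11 := hentry 1 1
    have h22 := hentry 2 2
    simp [conjMatrix, hu0, hu1, hu2, hu3, hA'] at h00 h11 h22
    simp only [reducedNorm, hu0, hu1, hu2, hu3] at hn
    intro i
    fin_cases i
    · have : (y * z 0 : ℚ) = w 0 ^ 2 := by
        apply mul_left_cancel₀ haq
        simp only [z, Matrix.cons_val_zero]
        push_cast
        linear_combination (1/64) * (hn + h00 - h11 - h22)
      exact_mod_cast this
    · have : (y * z 1 : ℚ) = w 1 ^ 2 := by
        apply mul_left_cancel₀ hbq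
        simp only [z, Matrix.cons_val_one]
        push_cast
        linear_combination (1/64) * (hn - h00 + h11 - h22)
      exact_mod_cast this
    · have : (y * z 2 : ℚ) = w 2 ^ 2 := by
        apply mul_left_cancel₀ (mul_ne_zero haq hbq)
        simp only [z, Matrix.cons_val]
        push_cast
        linear_combination (-1/64) * (hn - h00 - h11 + h22)
      exact_mod_cast this
  obtain ⟨d, s₀, s, hy', hw', hz'⟩ := exists_squarefree_mul_of_mul_eq_sq y hy w z hz
  -- The traces of `E` cancel in `y - a z₀ - b z₁ + a b z₂`, so `d` divides 1. Once `d = 1`, this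
  -- identity says that `(s₀, s)` has reduced norm one.
  have hsum : d * (s₀ ^ 2 - a * s 0 ^ 2 - b * s 1 ^ 2 + a * b * s 2 ^ 2) = 1 := by
    have : y - a * z 0 - b * z 1 + a * b * z 2 = 1 := by simp [y, z]; ring
    rw [← this, hy', hz', hz', hz']; ring
  have hd : d = 1 := by
    rcases Int.isUnit_iff.mp (IsUnit.of_mul_eq_one _ hsum) with h | h
    · exact h
    · exfalso
      -- The negative of a square is 0 or 3 modulo 4, which excludes `d = -1`.
      have h4 : y % 4 = 1 := by
        have : y = 1 + 4 * (a * b * (E 0 0 + E 1 1 + E 2 2)) := by simp only [y]; ring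
        omega
      rw [hy', h] at h4
      rcases Int.even_or_odd' s₀ with ⟨k, rfl | rfl⟩
      · have : -1 * (2 * k) ^ 2 = 4 * (-k ^ 2) := by ring
        omega
      · have : -1 * (2 * k + 1) ^ 2 = 4 * (-k ^ 2 - k) - 1 := by ring
        omega
  subst hd
  refine ⟨⟨s₀, s 0, s 1, s 2⟩, by simp only [reducedNorm]; linarith, ?_⟩
  have hs₀ : s₀ ≠ 0 := by rintro rfl; simp at hy'; exact hy hy'
  have hux : u = (4 * s₀ : ℚ) • (⟨s₀, s 0, s 1, s 2⟩ : ℍ[ℚ, (a : ℚ), 0, (b : ℚ)]) := by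
    ext <;> simp [hu0, hu1, hu2, hu3, hy', hw'] <;> ring
  have hq : conjMatrix (⟨s₀, s 0, s 1, s 2⟩ : ℍ[ℚ, (a : ℚ), 0, (b : ℚ)]) =
      A.map (Int.castRingHom ℚ) := by
    have h16 : (16 * s₀ ^ 2 : ℚ) ≠ 0 := by positivity
    apply smul_right_injective _ h16
    simp only
    rw [hux, conjMatrix_smul] at hc
    have h2 : 4 * ((4 * s₀ : ℚ) •
      (⟨s₀, s 0, s 1, s 2⟩ : ℍ[ℚ, (a : ℚ), 0, (b : ℚ)])).re = 16 * s₀ ^ 2 := by simp; ring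
    rw [h2] at hc
    rw [← hc]
    congr 1
    ring
  have hm := conjMatrix_map (Int.castRingHom ℚ) (⟨s₀, s 0, s 1, s 2⟩ : ℍ[ℤ, a, 0, b])
  exact Matrix.map_injective (RingHom.injective_int (Int.castRingHom ℚ)) (hm.trans hq)

end QuaternionAlgebra

namespace QuaternionAlgebra

section CommRing

variable {R : Type*} [CommRing R] {a b : R}

theorem reducedNorm_mul (x y : ℍ[R, a, 0, b]) :
    reducedNorm (x * y) = reducedNorm x * reducedNorm y := by
  simp [reducedNorm]; ring

theorem conjMatrix_coe (c : R) : conjMatrix (c : ℍ[R, a, 0, b]) = c ^ 2 • 1 := by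
  ext r s; fin_cases r <;> fin_cases s <;> simp [conjMatrix]

/-- The action of the quaternions by `v ↦ x v x̄`, as a monoid homomorphism. -/
def conjHom (a b : R) : ℍ[R, a, 0, b] →* Matrix (Fin 3) (Fin 3) R where
  toFun := conjMatrix
  map_one' := conjMatrix_one
  map_mul' := conjMatrix_mul

/-- The action of the quaternions of reduced norm one on the pure quaternions. -/
def conjGL (a b : R) : unitary ℍ[R, a, 0, b] →* GL (Fin 3) R :=
  ((conjHom a b).comp (unitary ℍ[R, a, 0, b]).subtype).toHomUnits

@[simp]
theorem coe_conjGL (x : unitary ℍ[R, a, 0, b]) :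
    (conjGL a b x : Matrix (Fin 3) (Fin 3) R) = conjMatrix (x : ℍ[R, a, 0, b]) := rfl

theorem reducedNorm_coe_unitary (x : unitary ℍ[R, a, 0, b]) :
    reducedNorm (x : ℍ[R, a, 0, b]) = 1 :=
  mem_unitary_iff_reducedNorm.mp x.2

end CommRing

/-! ### Real quaternions: image and kernel of the action, connectedness -/

section Real

variable {a b : ℝ}

theorem exists_conjMatrix_eq_of_trace_pos (ha : a ≠ 0) (hb : b ≠ 0)
    {A : Matrix (Fin 3) (Fin 3) ℝ} (hA : Aᵀ * pureGram a b * A = pureGram a b) (hdet : A.det = 1)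
    (htr : 0 < 1 + A 0 0 + A 1 1 + A 2 2) :
    ∃ x : ℍ[ℝ, a, 0, b], reducedNorm x = 1 ∧ conjMatrix x = A := by
  obtain ⟨hn, hc⟩ := reducedNorm_and_conjMatrix_rotationLift ha hb A hA hdet
  have hpos : 0 < 4 * (rotationLift a b A).re := mul_pos four_pos htr
  have hsq : (√(4 * (rotationLift a b A).re))⁻¹ ^ 2 * (4 * (rotationLift a b A).re) = 1 := by
    rw [inv_pow, Real.sq_sqrt hpos.le, inv_mul_cancel₀ hpos.ne']
  refine ⟨(√(4 * (rotationLift a b A).re))⁻¹ • rotationLift a b A, ?_, ?_⟩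
  · rw [reducedNorm_smul, hn, hsq]
  · rw [conjMatrix_smul, hc, smul_smul, hsq, one_smul]

theorem pureGram_mul_isometry {R : Type*} [CommRing R] {J A B : Matrix (Fin 3) (Fin 3) R}
    (hA : Aᵀ * J * A = J) (hB : Bᵀ * J * B = J) : (A * B)ᵀ * J * (A * B) = J := by
  calc (A * B)ᵀ * J * (A * B) = Bᵀ * (Aᵀ * J * A) * B := by
        rw [Matrix.transpose_mul]; simp only [Matrix.mul_assoc]
    _ = J := by rw [hA, hB]

/-- The lift can be normalised only if `1 + tr A > 0`. Otherwise one lifts `A` composed with a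
half-turn `e` and multiplies the result by `e`. -/
theorem exists_conjMatrix_eq_of_trace_mul_pos (ha : a ≠ 0) (hb : b ≠ 0)
    {A : Matrix (Fin 3) (Fin 3) ℝ} (hA : Aᵀ * pureGram a b * A = pureGram a b) (hdet : A.det = 1)
    (e : ℍ[ℝ, a, 0, b]) (he : reducedNorm e = 1) (he' : conjMatrix e * conjMatrix e = 1)
    (htr : 0 < 1 + A 0 0 + A 1 1 + A 2 2 ∨ 0 < 1 + (A * conjMatrix e) 0 0 +
      (A * conjMatrix e) 1 1 + (A * conjMatrix e) 2 2) :
    ∃ x : ℍ[ℝ, a, 0, b], reducedNorm x = 1 ∧ conjMatrix x = A := by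
  rcases htr with htr | htr
  · exact exists_conjMatrix_eq_of_trace_pos ha hb hA hdet htr
  · obtain ⟨x, hx, hxA⟩ := exists_conjMatrix_eq_of_trace_pos ha hb
      (pureGram_mul_isometry hA (by simpa [he] using conjMatrix_transpose_mul_pureGram_mul e))
      (by rw [Matrix.det_mul, hdet, det_conjMatrix, he]; norm_num) htr
    refine ⟨x * e, by rw [reducedNorm_mul, hx, he, one_mul], ?_⟩
    rw [conjMatrix_mul, hxA, Matrix.mul_assoc, he', Matrix.mul_one]

/-- The rotations of the pure quaternions coming from quaternions of norm one are recognised by the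
sign of the diagonal entry at a basis vector of negative square. -/
theorem exists_diagonal_entry_detecting_conjMatrix (ha : a ≠ 0) (hb : 0 < b) :
    ∃ m : Fin 3,
      (∀ A : Matrix (Fin 3) (Fin 3) ℝ, Aᵀ * pureGram a b * A = pureGram a b → A m m ≠ 0) ∧
      ∀ A : Matrix (Fin 3) (Fin 3) ℝ, Aᵀ * pureGram a b * A = pureGram a b → A.det = 1 →
        0 < A m m → ∃ x : ℍ[ℝ, a, 0, b], reducedNorm x = 1 ∧ conjMatrix x = A := by
  rcases ha.lt_or_gt with ha' | ha'
  · obtain ⟨t, hs⟩ : ∃ t : ℝ, t ^ 2 * -a = 1 :=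
      ⟨(√(-a))⁻¹, by rw [inv_pow, Real.sq_sqrt (by linarith), inv_mul_cancel₀ (by linarith)]⟩
    refine ⟨0, fun A hA h0 => ?_, fun A hA hdet hpos => ?_⟩
    -- For `a < 0` the form is negative on `i` and positive on `j` and `k`. If `A 0 0` vanished, the
    -- image of `i` would lie in the positive plane.
    · have h := congrFun (congrFun hA 0) 0
      simp [pureGram, Matrix.mul_apply, Fin.sum_univ_three, h0] at h
      nlinarith [mul_nonneg hb.le (sq_nonneg (A 1 0)),
        mul_nonneg (mul_nonneg (neg_nonneg.mpr ha'.le) hb.le) (sq_nonneg (A 2 0))]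
    · have hE : conjMatrix (⟨0, t, 0, 0⟩ : ℍ[ℝ, a, 0, b]) =
          !![1, 0, 0; 0, -1, 0; 0, 0, -1] := by
        ext r s; fin_cases r <;> fin_cases s <;> simp only [conjMatrix] <;>
          simp <;> linarith
      refine exists_conjMatrix_eq_of_trace_mul_pos ha hb.ne' hA hdet ⟨0, t, 0, 0⟩ ?_ ?_ ?_
      · simp only [reducedNorm]; linarith
      · rw [hE]; ext r s; fin_cases r <;> fin_cases s <;> simp [Matrix.mul_apply, Fin.sum_univ_three]
      · rw [hE]
        -- With the half-turn about `i`, the two quantities add up to `2 + 2 A 0 0 > 0`, so one of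
        -- them is positive.
        by_contra! h
        simp [Matrix.mul_apply, Fin.sum_univ_three] at h
        linarith [h.1, h.2]
  · have hab := mul_pos ha' hb
    -- For `a > 0` the negative direction is `k`, and the same argument applies with the half-turn
    -- about `k`.
    obtain ⟨t, hs⟩ : ∃ t : ℝ, t ^ 2 * (a * b) = 1 :=
      ⟨(√(a * b))⁻¹, by rw [inv_pow, Real.sq_sqrt hab.le, inv_mul_cancel₀ hab.ne']⟩
    refine ⟨2, fun A hA h0 => ?_, fun A hA hdet hpos => ?_⟩
    · have h := congrFun (congrFun hA 2) 2
      simp [pureGram, Matrix.mul_apply, Fin.sum_univ_three, h0] at h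
      nlinarith [mul_nonneg hb.le (sq_nonneg (A 1 2)), mul_nonneg ha'.le (sq_nonneg (A 0 2))]
    · have hE : conjMatrix (⟨0, 0, 0, t⟩ : ℍ[ℝ, a, 0, b]) =
          !![-1, 0, 0; 0, -1, 0; 0, 0, 1] := by
        ext r s; fin_cases r <;> fin_cases s <;> simp only [conjMatrix] <;>
          simp <;> linarith
      refine exists_conjMatrix_eq_of_trace_mul_pos ha hb.ne' hA hdet ⟨0, 0, 0, t⟩ ?_ ?_ ?_
      · simp only [reducedNorm]; linarith
      · rw [hE]; ext r s; fin_cases r <;> fin_cases s <;> simp [Matrix.mul_apply, Fin.sum_univ_three]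
      · rw [hE]
        by_contra! h
        simp [Matrix.mul_apply, Fin.sum_univ_three] at h
        linarith [h.1, h.2]

/-- An isomorphism of the quaternion algebra `(a, r²)` with the algebra of `2 × 2` matrices. -/
def algEquivMatrixOfSq {F : Type*} [Field F] [NeZero (2 : F)] {a b r : F} (ha : a ≠ 0) (hr : r ≠ 0)
    (hb : r ^ 2 = b) : ℍ[F, a, 0, b] ≃ₐ[F] Matrix (Fin 2) (Fin 2) F where
  toFun x := !![x.re + r * x.imJ, a * (x.imI - r * x.imK);
    x.imI + r * x.imK, x.re - r * x.imJ]
  invFun M := ⟨(M 0 0 + M 1 1) / 2, (M 0 1 / a + M 1 0) / 2, (M 0 0 - M 1 1) / (2 * r),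
    (M 1 0 - M 0 1 / a) / (2 * r)⟩
  left_inv x := by
    have h2 : (2 : F) ≠ 0 := NeZero.ne 2
    ext <;> simp <;> field_simp <;> ring
  right_inv M := by
    have h2 : (2 : F) ≠ 0 := NeZero.ne 2
    ext r s; fin_cases r <;> fin_cases s <;> simp <;> field_simp <;> ring
  map_mul' x y := by
    ext r s; fin_cases r <;> fin_cases s <;> simp [Matrix.mul_apply] <;> grind
  map_add' x y := by
    ext r s; fin_cases r <;> fin_cases s <;> simp <;> ring
  commutes' c := by
    ext r s; fin_cases r <;> fin_cases s <;> simp [algebraMap_eq, Matrix.algebraMap_matrix_apply]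

/-- An isomorphism of the real quaternion algebra `(a, b)` with `M₂(ℝ)` for `b > 0`. -/
noncomputable def algEquivMatrix (ha : a ≠ 0) (hb : 0 < b) :
    ℍ[ℝ, a, 0, b] ≃ₐ[ℝ] Matrix (Fin 2) (Fin 2) ℝ :=
  algEquivMatrixOfSq ha (Real.sqrt_pos.mpr hb).ne' (Real.sq_sqrt hb.le)

theorem det_algEquivMatrix (ha : a ≠ 0) (hb : 0 < b) (x : ℍ[ℝ, a, 0, b]) :
    (algEquivMatrix ha hb x).det = reducedNorm x := by
  have hs : √b ^ 2 = b := Real.sq_sqrt hb.le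
  simp only [algEquivMatrix, algEquivMatrixOfSq, AlgEquiv.coe_mk, Equiv.coe_fn_mk, Matrix.det_fin_two_of, reducedNorm]
  linear_combination (a * x.imK ^ 2 - x.imJ ^ 2) * hs

theorem continuous_of_components {X : Type*} [TopologicalSpace X] {f : X → ℍ[ℝ, a, 0, b]}
    (h₀ : Continuous fun x => (f x).re) (h₁ : Continuous fun x => (f x).imI)
    (h₂ : Continuous fun x => (f x).imJ) (h₃ : Continuous fun x => (f x).imK) : Continuous f := by
  refine continuous_induced_rng.mpr (continuous_pi fun i => ?_)
  fin_cases i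
  exacts [h₀, h₁, h₂, h₃]

theorem continuous_equivTuple : Continuous (equivTuple a 0 b) := continuous_induced_dom

@[fun_prop]
theorem continuous_re' : Continuous fun x : ℍ[ℝ, a, 0, b] => x.re :=
  (continuous_apply (0 : Fin 4)).comp continuous_equivTuple

@[fun_prop]
theorem continuous_imI' : Continuous fun x : ℍ[ℝ, a, 0, b] => x.imI :=
  (continuous_apply (1 : Fin 4)).comp continuous_equivTuple

@[fun_prop]
theorem continuous_imJ' : Continuous fun x : ℍ[ℝ, a, 0, b] => x.imJ :=
  (continuous_apply (2 : Fin 4)).comp continuous_equivTuple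

@[fun_prop]
theorem continuous_imK' : Continuous fun x : ℍ[ℝ, a, 0, b] => x.imK :=
  (continuous_apply (3 : Fin 4)).comp continuous_equivTuple

theorem continuous_conjMatrix :
    Continuous (conjMatrix : ℍ[ℝ, a, 0, b] → Matrix (Fin 3) (Fin 3) ℝ) := by
  refine continuous_matrix fun r s => ?_
  fin_cases r <;> fin_cases s <;> simp [conjMatrix] <;> fun_prop

theorem continuous_conjGL : Continuous (conjGL a b) := by
  rw [Units.continuous_iff]
  refine ⟨continuous_conjMatrix.comp continuous_subtype_val, continuous_conjMatrix.comp ?_⟩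
  change Continuous fun x : unitary ℍ[ℝ, a, 0, b] => star (x : ℍ[ℝ, a, 0, b])
  refine continuous_of_components ?_ ?_ ?_ ?_ <;> simp <;> fun_prop

theorem continuous_algEquivMatrix_symm (ha : a ≠ 0) (hb : 0 < b) :
    Continuous (algEquivMatrix ha hb).symm := by
  have h : ∀ i j : Fin 2, Continuous fun M : Matrix (Fin 2) (Fin 2) ℝ => M i j :=
    fun i j => continuous_id.matrix_elem i j
  refine continuous_of_components ?_ ?_ ?_ ?_
  · exact ((h 0 0).add (h 1 1)).div_const _
  · exact (((h 0 1).div_const _).add (h 1 0)).div_const _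
  · exact ((h 0 0).sub (h 1 1)).div_const _
  · exact ((h 1 0).sub ((h 0 1).div_const _)).div_const _

/-- Every real matrix of determinant one is a product of four elementary matrices. -/
theorem exists_transvections_of_det_eq_one {F : Type*} [Field F] (M : Matrix (Fin 2) (Fin 2) F)
    (hM : M.det = 1) : ∃ t : F × F × F × F,
      !![1, t.1; 0, 1] * !![1, 0; t.2.1, 1] * !![1, t.2.2.1; 0, 1] * !![1, 0; t.2.2.2, 1] = M := by
  rw [Matrix.det_fin_two] at hM
  -- Subtracting `e` times the second column from the first makes the lower left entry nonzero. A
  -- matrix of determinant one with that property is upper times lower times upper.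
  obtain ⟨e, he⟩ : ∃ e : F, M 1 0 - e * M 1 1 ≠ 0 := by
    by_cases h : M 1 0 = 0
    · refine ⟨1, fun h' => ?_⟩
      have : M 1 1 = 0 := by linear_combination -h' + h
      rw [h, this] at hM
      simp at hM
    · exact ⟨0, by simpa using h⟩
  refine ⟨⟨(M 0 0 - e * M 0 1 - 1) / (M 1 0 - e * M 1 1), M 1 0 - e * M 1 1,
    (M 1 1 - 1) / (M 1 0 - e * M 1 1), e⟩, ?_⟩
  ext r s
  fin_cases r <;> fin_cases s <;> simp [Matrix.mul_apply] <;> field_simp <;> grind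

/-- Through `algEquivMatrix` the group is `SL₂(ℝ)`, which is the image of `ℝ⁴` under a continuous
product of four elementary matrices. -/
theorem preconnectedSpace_unitary (ha : a ≠ 0) (hb : 0 < b) :
    PreconnectedSpace (unitary ℍ[ℝ, a, 0, b]) := by
  let g : ℝ × ℝ × ℝ × ℝ → Matrix (Fin 2) (Fin 2) ℝ := fun t =>
    !![1, t.1; 0, 1] * !![1, 0; t.2.1, 1] * !![1, t.2.2.1; 0, 1] * !![1, 0; t.2.2.2, 1]
  have hg : Continuous g := by
    refine Continuous.matrix_mul (Continuous.matrix_mul (Continuous.matrix_mul ?_ ?_) ?_) ?_ <;>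
    · refine continuous_matrix fun r s => ?_
      fin_cases r <;> fin_cases s <;> simp <;> fun_prop
  have hmem : ∀ t, (algEquivMatrix ha hb).symm (g t) ∈ unitary ℍ[ℝ, a, 0, b] := fun t => by
    rw [mem_unitary_iff_reducedNorm, ← det_algEquivMatrix ha hb, AlgEquiv.apply_symm_apply]
    simp only [g, Matrix.det_mul, Matrix.det_fin_two_of]
    norm_num
  let f : ℝ × ℝ × ℝ × ℝ → unitary ℍ[ℝ, a, 0, b] := fun t =>
    ⟨(algEquivMatrix ha hb).symm (g t), hmem t⟩
  have hf : Continuous f := ((continuous_algEquivMatrix_symm ha hb).comp hg).subtype_mk _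
  have hsurj : Function.Surjective f := fun x => by
    obtain ⟨t, ht⟩ := exists_transvections_of_det_eq_one (algEquivMatrix ha hb x)
      (by rw [det_algEquivMatrix, reducedNorm_coe_unitary])
    exact ⟨t, Subtype.ext (by
      change (algEquivMatrix ha hb).symm (g t) = x
      rw [show g t = _ from ht, AlgEquiv.symm_apply_apply])⟩
  exact hsurj.denseRange.preconnectedSpace hf

theorem conjMatrix_eq_smul_one_iff (ha : a ≠ 0) (hb : 0 < b) (x : unitary ℍ[ℝ, a, 0, b]) :
    (∃ t : ℝ, conjMatrix (x : ℍ[ℝ, a, 0, b]) = t • 1) ↔ x ∈ Subgroup.center _ := by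
  have hx := reducedNorm_coe_unitary x
  constructor
  · rintro ⟨t, ht⟩
    have hdet := det_conjMatrix (x : ℍ[ℝ, a, 0, b])
    rw [ht, hx, Matrix.det_smul] at hdet
    have ht1 : t = 1 := by
      have h3 : t ^ 3 = 1 := by simpa using hdet
      exact (Odd.pow_inj (n := 3) (by decide)).mp (by simpa using h3)
    rw [ht1, one_smul] at ht
    have h00 := congrFun (congrFun ht 0) 0
    have h11 := congrFun (congrFun ht 1) 1
    have h22 := congrFun (congrFun ht 2) 2
    simp [conjMatrix] at h00 h11 h22
    rw [reducedNorm] at hx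
    have h1 : (x : ℍ[ℝ, a, 0, b]).imI = 0 := by
      have : a * (x : ℍ[ℝ, a, 0, b]).imI ^ 2 = 0 := by linarith
      simpa [ha] using this
    have h2 : (x : ℍ[ℝ, a, 0, b]).imJ = 0 := by
      have : b * (x : ℍ[ℝ, a, 0, b]).imJ ^ 2 = 0 := by linarith
      simpa [hb.ne'] using this
    have h3 : (x : ℍ[ℝ, a, 0, b]).imK = 0 := by
      have : (a * b) * (x : ℍ[ℝ, a, 0, b]).imK ^ 2 = 0 := by linarith
      simpa [ha, hb.ne'] using this
    have hx' : (x : ℍ[ℝ, a, 0, b]) = ((x : ℍ[ℝ, a, 0, b]).re : ℍ[ℝ, a, 0, b]) := by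
      ext <;> simp [h1, h2, h3]
    refine Subgroup.mem_center_iff.mpr fun y => Subtype.ext ?_
    rw [Submonoid.coe_mul, Submonoid.coe_mul, hx']
    exact (coe_commutes _ _).symm
  · intro hc
    have hs : √b ≠ 0 := (Real.sqrt_pos.mpr hb).ne'
    have hs2 : √b ^ 2 = b := Real.sq_sqrt hb.le
    have key : ∀ v : ℍ[ℝ, a, 0, b], reducedNorm v = 1 →
        v * (x : ℍ[ℝ, a, 0, b]) = x * v := fun v hv =>
      congrArg Subtype.val (Subgroup.mem_center_iff.mp hc ⟨v, mem_unitary_iff_reducedNorm.mpr hv⟩)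
    -- The elements `1 + √b i ± k` have norm one because `√b i ± k` is nilpotent. Commuting with
    -- both means commuting with `i` and `k`, which generate the algebra.
    have e1 := key ⟨1, √b, 0, -1⟩ (by simp only [reducedNorm]; linear_combination (-a) * hs2)
    have e2 := key ⟨1, √b, 0, 1⟩ (by simp only [reducedNorm]; linear_combination (-a) * hs2)
    have e11 := congrArg imI e1
    have e12 := congrArg imJ e1
    have e22 := congrArg imJ e2
    simp at e11 e12 e22
    have h2 : (x : ℍ[ℝ, a, 0, b]).imJ = 0 := by
      have : b * (x : ℍ[ℝ, a, 0, b]).imJ = 0 := by linarith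
      simpa [hb.ne'] using this
    have h1 : (x : ℍ[ℝ, a, 0, b]).imI = 0 := by
      have : a * (x : ℍ[ℝ, a, 0, b]).imI = 0 := by linarith
      simpa [ha] using this
    have h3 : (x : ℍ[ℝ, a, 0, b]).imK = 0 := by
      have : (a * √b) * (x : ℍ[ℝ, a, 0, b]).imK = 0 := by linarith
      simpa [ha, hs] using this
    refine ⟨(x : ℍ[ℝ, a, 0, b]).re ^ 2, ?_⟩
    have hx' : (x : ℍ[ℝ, a, 0, b]) = ((x : ℍ[ℝ, a, 0, b]).re : ℍ[ℝ, a, 0, b]) := by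
      ext <;> simp [h1, h2, h3]
    rw [hx', conjMatrix_coe, re_coe]

end Real

end QuaternionAlgebra

open QuaternionAlgebra

open scoped ComplexConjugate

/-! ### Conjugates of `PO(1,2)` as orthogonal groups of pure quaternions -/

section Isometry

variable {R : Type*} [CommRing R]

/-- Transport of an isometry along a change of basis. -/
theorem isometry_conj {J G : Matrix (Fin 3) (Fin 3) R} {T X : GL (Fin 3) R}
    (hT : (T : Matrix (Fin 3) (Fin 3) R)ᵀ * J * T = G)
    (hX : (X : Matrix (Fin 3) (Fin 3) R)ᵀ * J * X = J) :
    ((T⁻¹ * X * T : GL (Fin 3) R) : Matrix (Fin 3) (Fin 3) R)ᵀ * G *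
      ((T⁻¹ * X * T : GL (Fin 3) R) : Matrix (Fin 3) (Fin 3) R) = G := by
  have h : (T : Matrix (Fin 3) (Fin 3) R) * ((T⁻¹ * X * T : GL (Fin 3) R) : Matrix (Fin 3) (Fin 3) R) =
      X * T := by
    rw [← Units.val_mul, ← Units.val_mul]; congr 1; group
  generalize ((T⁻¹ * X * T : GL (Fin 3) R) : Matrix (Fin 3) (Fin 3) R) = A at h ⊢
  calc Aᵀ * G * A = ((T : Matrix (Fin 3) (Fin 3) R) * A)ᵀ * J *
        ((T : Matrix (Fin 3) (Fin 3) R) * A) := by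
        rw [← hT, Matrix.transpose_mul]; simp only [Matrix.mul_assoc]
    _ = (T : Matrix (Fin 3) (Fin 3) R)ᵀ * ((X : Matrix (Fin 3) (Fin 3) R)ᵀ * J * X) * T := by
        rw [h, Matrix.transpose_mul]; simp only [Matrix.mul_assoc]
    _ = G := by rw [hX, hT]

end Isometry

/-- The matrix of the form `h`, as a real matrix. -/
noncomputable def realFormMatrix : Matrix (Fin 3) (Fin 3) ℝ :=
  !![0, 0, -1/2; 0, 1, 0; -1/2, 0, 0]

theorem realFormMatrix_map : realFormMatrix.map Complex.ofRealHom = hermMatrix := by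
  ext r s; fin_cases r <;> fin_cases s <;> simp [realFormMatrix, hermMatrix]

theorem ofReal_map_conjTranspose (A : Matrix (Fin 3) (Fin 3) ℝ) :
    (A.map Complex.ofRealHom)ᴴ = Aᵀ.map Complex.ofRealHom := by
  ext r s; simp

theorem ofReal_map_isometry_iff {A G H : Matrix (Fin 3) (Fin 3) ℝ} :
    (A.map Complex.ofRealHom)ᴴ * G.map Complex.ofRealHom * A.map Complex.ofRealHom =
      H.map Complex.ofRealHom ↔ Aᵀ * G * A = H := by
  rw [ofReal_map_conjTranspose, ← Matrix.map_mul, ← Matrix.map_mul]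
  exact (Matrix.map_injective Complex.ofRealHom.injective).eq_iff

theorem coe_GL_map {n : Type*} [Fintype n] [DecidableEq n] {R S : Type*} [CommRing R] [CommRing S]
    (f : R →+* S) (A : GL n R) :
    (Matrix.GeneralLinearGroup.map f A : Matrix n n S) = (A : Matrix n n R).map f := rfl

theorem ofReal_map_mem_U12_iff {A : GL (Fin 3) ℝ} :
    Matrix.GeneralLinearGroup.map Complex.ofRealHom A ∈ U12 ↔
      (A : Matrix (Fin 3) (Fin 3) ℝ)ᵀ * realFormMatrix * A = realFormMatrix := by
  rw [← ofReal_map_isometry_iff, realFormMatrix_map]; rfl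

/-- A real basis of `ℝ³` in which the form `h` is the square form on the pure quaternions. -/
theorem exists_isometry_pureGram {a b : ℝ} (ha : a ≠ 0) (hb : 0 < b) :
    ∃ T : GL (Fin 3) ℝ,
      (T : Matrix (Fin 3) (Fin 3) ℝ)ᵀ * realFormMatrix * T = pureGram a b := by
  have hs : √b ≠ 0 := (Real.sqrt_pos.mpr hb).ne'
  have hs2 : √b ^ 2 = b := Real.sq_sqrt hb.le
  -- The first and third columns are orthogonal vectors of the hyperbolic plane in the coordinates 0
  -- and 2, where `h = -z₀z₂` takes the values `a` and `-ab`.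
  refine ⟨Matrix.GeneralLinearGroup.mkOfDetNeZero !![a, 0, -a * √b; 0, √b, 0; -1, 0, -√b] ?_, ?_⟩
  · simp only [Matrix.det_fin_three, Matrix.of_apply, Matrix.cons_val]
    intro h
    have : a * √b ^ 2 = 0 := by linarith
    exact mul_ne_zero ha (pow_ne_zero 2 hs) this
  · change !![a, 0, -a * √b; 0, √b, 0; -1, 0, -√b]ᵀ * realFormMatrix *
      !![a, 0, -a * √b; 0, √b, 0; -1, 0, -√b] = _
    ext r s
    fin_cases r <;> fin_cases s <;>
      simp [Matrix.mul_apply, Fin.sum_univ_three, realFormMatrix, pureGram] <;> grind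

/-- The homomorphism sending a real matrix `A` to the class of `P A P⁻¹`. -/
noncomputable def frameHom (P : GL (Fin 3) ℂ) : GL (Fin 3) ℝ →* PGL(3, ℂ) :=
  Matrix.ProjGenLinGroup.mk.comp
    ((MulAut.conj P).toMonoidHom.comp (Matrix.GeneralLinearGroup.map Complex.ofRealHom))

theorem frameHom_apply (P : GL (Fin 3) ℂ) (A : GL (Fin 3) ℝ) :
    frameHom P A = Matrix.ProjGenLinGroup.mk
      (P * Matrix.GeneralLinearGroup.map Complex.ofRealHom A * P⁻¹) := rfl

theorem mem_conjPO12_iff {a b : ℝ} {P : GL (Fin 3) ℂ} {T : GL (Fin 3) ℝ}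
    (hT : (T : Matrix (Fin 3) (Fin 3) ℝ)ᵀ * realFormMatrix * T = pureGram a b) (x : PGL(3, ℂ)) :
    x ∈ conjPO12 (Matrix.ProjGenLinGroup.mk
        (P * (Matrix.GeneralLinearGroup.map Complex.ofRealHom T)⁻¹)) ↔
      ∃ A : GL (Fin 3) ℝ, (A : Matrix (Fin 3) (Fin 3) ℝ)ᵀ * pureGram a b * A = pureGram a b ∧
        frameHom P A = x := by
  have hT' : ((T⁻¹ : GL (Fin 3) ℝ) : Matrix (Fin 3) (Fin 3) ℝ)ᵀ * pureGram a b *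
      ((T⁻¹ : GL (Fin 3) ℝ) : Matrix (Fin 3) (Fin 3) ℝ) = realFormMatrix := by
    have h : (T : Matrix (Fin 3) (Fin 3) ℝ) * ((T⁻¹ : GL (Fin 3) ℝ) : Matrix _ _ ℝ) = 1 := T.mul_inv
    rw [← hT]
    calc _ = ((T : Matrix (Fin 3) (Fin 3) ℝ) * ((T⁻¹ : GL (Fin 3) ℝ) : Matrix _ _ ℝ))ᵀ *
          realFormMatrix * ((T : Matrix (Fin 3) (Fin 3) ℝ) * ((T⁻¹ : GL (Fin 3) ℝ) : Matrix _ _ ℝ))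
          := by rw [Matrix.transpose_mul]; simp only [Matrix.mul_assoc]
      _ = _ := by rw [h]; simp
  constructor
  · rintro ⟨y, ⟨Z, ⟨hZ, ⟨R, rfl⟩⟩, rfl⟩, rfl⟩
    refine ⟨T⁻¹ * R * T, isometry_conj hT (ofReal_map_mem_U12_iff.mp hZ), ?_⟩
    rw [frameHom_apply]
    simp only [MulEquiv.coe_toMonoidHom, MulAut.conj_apply, ← map_mul, ← map_inv]
    congr 1
    simp only [map_mul, map_inv]
    group
  · rintro ⟨A, hA, rfl⟩
    have hR := isometry_conj hT' hA
    refine ⟨_, ⟨_, ⟨ofReal_map_mem_U12_iff.mpr hR, ⟨_, rfl⟩⟩, rfl⟩, ?_⟩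
    rw [frameHom_apply]
    simp only [MulEquiv.coe_toMonoidHom, MulAut.conj_apply, ← map_mul, ← map_inv]
    congr 1
    simp only [map_mul, map_inv]
    group

theorem continuous_pgl_mk :
    Continuous (Matrix.ProjGenLinGroup.mk : GL (Fin 3) ℂ →* PGL(3, ℂ)) :=
  continuous_coinduced_rng

theorem continuous_frameHom (P : GL (Fin 3) ℂ) : Continuous (frameHom P) := by
  have h : Continuous (Matrix.GeneralLinearGroup.map (n := Fin 3) Complex.ofRealHom) := by
    have hm : Continuous fun M : Matrix (Fin 3) (Fin 3) ℝ => M.map Complex.ofRealHom :=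
      continuous_id.matrix_map Complex.continuous_ofReal
    rw [Units.continuous_iff]
    exact ⟨hm.comp Units.continuous_val, hm.comp (Units.continuous_val.comp continuous_inv)⟩
  exact continuous_pgl_mk.comp ((continuous_const.mul h).mul continuous_const)

/-- A continuous function on `PGL₃(ℂ)`: a diagonal coefficient in the frame `P`, normalised by the
determinant. -/
theorem exists_continuous_diagonal_entry (P : GL (Fin 3) ℂ) (m : Fin 3) :
    ∃ F : PGL(3, ℂ) → ℂ, Continuous F ∧ ∀ A : GL (Fin 3) ℝ, F (frameHom P A) =
      (((A : Matrix (Fin 3) (Fin 3) ℝ) m m ^ 3 / (A : Matrix (Fin 3) (Fin 3) ℝ).det : ℝ) : ℂ) := by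
  let f : GL (Fin 3) ℂ → ℂ := fun X => ((P⁻¹ * X * P : GL (Fin 3) ℂ) : Matrix _ _ ℂ) m m ^ 3 /
    (X : Matrix (Fin 3) (Fin 3) ℂ).det
  have hf : Continuous f := by
    refine Continuous.div ?_ ?_ fun X => ?_
    · exact (((Units.continuous_val.comp
        ((continuous_const.mul continuous_id).mul continuous_const))).matrix_elem m m).pow 3
    · exact Units.continuous_val.matrix_det
    · exact X.det.ne_zero
  -- Scaling `X` by `u` multiplies both numerator and denominator by `u³`, so `f` depends only on
  -- the class of `X`.
  have hinv : ∀ X Y : GL (Fin 3) ℂ,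
      Matrix.ProjGenLinGroup.mk X = Matrix.ProjGenLinGroup.mk Y → f X = f Y := fun X Y h => by
    obtain ⟨u, rfl⟩ := Matrix.ProjGenLinGroup.mk_eq_mk_iff.mp h
    have hs : ((X * Matrix.GeneralLinearGroup.scalar (Fin 3) u : GL (Fin 3) ℂ) :
        Matrix (Fin 3) (Fin 3) ℂ) =
        (u : ℂ) • (X : Matrix (Fin 3) (Fin 3) ℂ) := by
      rw [Units.val_mul, Matrix.GeneralLinearGroup.coe_scalar, Matrix.scalar_apply,
        ← Matrix.smul_one_eq_diagonal, Matrix.mul_smul, Matrix.mul_one]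
    have hX : (X : Matrix (Fin 3) (Fin 3) ℂ).det ≠ 0 := X.det.ne_zero
    have hu : (u : ℂ) ≠ 0 := u.ne_zero
    simp only [f]
    rw [Units.val_mul, Units.val_mul, Units.val_mul, Units.val_mul, hs, Matrix.mul_smul,
      Matrix.smul_mul, Matrix.smul_apply, Matrix.det_smul, smul_eq_mul, Fintype.card_fin]
    field_simp
  let F : PGL(3, ℂ) → ℂ := fun x => f (Function.surjInv Matrix.ProjGenLinGroup.mk_surjective x)
  have hF : ∀ X : GL (Fin 3) ℂ, F (Matrix.ProjGenLinGroup.mk X) = f X := fun X =>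
    hinv _ _ (Function.surjInv_eq _ _)
  refine ⟨F, continuous_coinduced_dom.mpr ?_, fun A => ?_⟩
  · exact hf.congr fun X => (hF X).symm
  · rw [frameHom_apply, hF]
    simp only [f]
    have h1 : P⁻¹ * (P * Matrix.GeneralLinearGroup.map Complex.ofRealHom A * P⁻¹) * P =
        Matrix.GeneralLinearGroup.map Complex.ofRealHom A := by group
    have h2 : ((P * Matrix.GeneralLinearGroup.map Complex.ofRealHom A * P⁻¹ : GL (Fin 3) ℂ) :
        Matrix (Fin 3) (Fin 3) ℂ).det = ((A : Matrix (Fin 3) (Fin 3) ℝ).det : ℂ) := by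
      rw [← Matrix.GeneralLinearGroup.val_det_apply]
      simp only [map_mul, map_inv, mul_inv_cancel_comm]
      rw [Matrix.GeneralLinearGroup.val_det_apply, coe_GL_map]
      exact (RingHom.map_det Complex.ofRealHom _).symm
    rw [h1, h2, coe_GL_map]
    simp

theorem det_sq_eq_one_of_isometry {F : Type*} [Field F] {a b : F} (ha : a ≠ 0) (hb : b ≠ 0)
    {A : Matrix (Fin 3) (Fin 3) F} (hA : Aᵀ * pureGram a b * A = pureGram a b) :
    A.det ^ 2 = 1 := by
  have h := congrArg Matrix.det hA
  have hG : (pureGram a b).det ≠ 0 := by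
    simp [Matrix.det_fin_three, pureGram, ha, hb]
  rw [Matrix.det_mul, Matrix.det_mul, Matrix.det_transpose] at h
  exact mul_left_cancel₀ hG (by linear_combination h)

/-- One inclusion is the connectedness of the norm one group. For the other, the function `A m m ^ 3
/ det A` is continuous on `PGL₃(ℂ)`, real and nonzero on `H`, and 1 at the identity, so it is
positive on the identity component. Positivity is exactly what is needed to lift `A` or `-A`. -/
theorem range_frameHom_conjGL_eq_identityComponent {a b : ℝ} (ha : a ≠ 0) (hb : 0 < b)
    (P : GL (Fin 3) ℂ) (H : Subgroup PGL(3, ℂ))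
    (hH : ∀ x, x ∈ H ↔ ∃ A : GL (Fin 3) ℝ,
      (A : Matrix (Fin 3) (Fin 3) ℝ)ᵀ * pureGram a b * A = pureGram a b ∧ frameHom P A = x) :
    Set.range ((frameHom P).comp (conjGL a b)) = identityComponent H := by
  apply Set.Subset.antisymm
  · have := preconnectedSpace_unitary ha hb
    refine (isPreconnected_range ((continuous_frameHom P).comp continuous_conjGL)
      ).subset_connectedComponentIn ⟨1, map_one ((frameHom P).comp (conjGL a b))⟩ ?_
    rintro _ ⟨x, rfl⟩
    exact (hH _).mpr ⟨conjGL a b x, by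
      simpa [reducedNorm_coe_unitary] using conjMatrix_transpose_mul_pureGram_mul (x : ℍ[ℝ, a, 0, b]),
      rfl⟩
  · obtain ⟨m, hm0, hm⟩ := exists_diagonal_entry_detecting_conjMatrix ha hb
    obtain ⟨F, hF, hFA⟩ := exists_continuous_diagonal_entry P m
    intro x hx
    have hxH : x ∈ H := connectedComponentIn_subset _ _ hx
    have hne : ∀ y ∈ H, (F y).re ≠ 0 := fun y hy => by
      obtain ⟨A, hA, rfl⟩ := (hH y).mp hy
      rw [hFA, Complex.ofReal_re]
      exact div_ne_zero (pow_ne_zero 3 (hm0 _ hA)) A.det.ne_zero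
    have hpos : 0 < (F x).re := by
      by_contra! hle
      have h1 : (1 : PGL(3, ℂ)) ∈ connectedComponentIn (H : Set PGL(3, ℂ)) 1 :=
        mem_connectedComponentIn H.one_mem
      have hF1 : F 1 = 1 := by
        have := hFA 1
        rwa [map_one, Units.val_one, Matrix.one_apply_eq, Matrix.det_one, one_pow, div_one,
          Complex.ofReal_one] at this
      obtain ⟨y, hy, hy0⟩ := isPreconnected_connectedComponentIn.intermediate_value hx h1
        (Complex.continuous_re.comp hF).continuousOn (show (0 : ℝ) ∈ Set.Icc _ _ from
          ⟨hle, by simp [hF1]⟩)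
      exact hne y (connectedComponentIn_subset _ _ hy) hy0
    obtain ⟨A, hA, rfl⟩ := (hH x).mp hxH
    rw [hFA, Complex.ofReal_re] at hpos
    have hlift : ∀ B : GL (Fin 3) ℝ, (B : Matrix (Fin 3) (Fin 3) ℝ)ᵀ * pureGram a b * B =
        pureGram a b → (B : Matrix (Fin 3) (Fin 3) ℝ).det = 1 →
        0 < (B : Matrix (Fin 3) (Fin 3) ℝ) m m → ∃ x, conjGL a b x = B := fun B h1 h2 h3 => by
      obtain ⟨q, hq, hqB⟩ := hm _ h1 h2 h3
      exact ⟨⟨q, mem_unitary_iff_reducedNorm.mpr hq⟩, Units.ext hqB⟩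
    rcases mul_self_eq_one_iff.mp ((sq _).symm.trans <| det_sq_eq_one_of_isometry ha hb.ne' hA) with hd | hd
    · rw [hd, div_one] at hpos
      obtain ⟨q, hq⟩ := hlift A hA hd ((Odd.pow_pos_iff (by decide)).mp hpos)
      exact ⟨q, congrArg (frameHom P) hq⟩
    -- In odd dimension `-A` has determinant one, and it defines the same class as `A`.
    · rw [hd, div_neg, div_one, ← Odd.neg_pow (by decide)] at hpos
      obtain ⟨q, hq⟩ := hlift (-A) (by simpa using hA) (by
        rw [Units.val_neg, Matrix.det_neg, hd]; norm_num)
        (by simpa using (Odd.pow_pos_iff (by decide)).mp hpos)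
      refine ⟨q, ?_⟩
      change frameHom P (conjGL a b q) = frameHom P A
      rw [hq, frameHom_apply, frameHom_apply, Matrix.ProjGenLinGroup.mk_eq_mk_iff]
      refine ⟨-1, Units.ext ?_⟩
      have : ((Matrix.GeneralLinearGroup.map Complex.ofRealHom (-A) : GL (Fin 3) ℂ) :
          Matrix (Fin 3) (Fin 3) ℂ) = -(A : Matrix (Fin 3) (Fin 3) ℝ).map Complex.ofRealHom := by
        ext r s; simp
      simp [this, Matrix.GeneralLinearGroup.coe_scalar, ← Matrix.smul_one_eq_diagonal]

theorem ker_frameHom_conjGL {a b : ℝ} (ha : a ≠ 0) (hb : 0 < b) (P : GL (Fin 3) ℂ) :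
    ((frameHom P).comp (conjGL a b)).ker = Subgroup.center (unitary ℍ[ℝ, a, 0, b]) := by
  ext x
  rw [← conjMatrix_eq_smul_one_iff ha hb, MonoidHom.mem_ker, MonoidHom.comp_apply, frameHom_apply,
    map_mul, map_mul, map_inv, conj_eq_one_iff, Matrix.ProjGenLinGroup.mk_eq_one,
    Matrix.GeneralLinearGroup.center_eq_range_scalar, MonoidHom.mem_range]
  constructor
  · rintro ⟨u, hu⟩
    have hum : ((Matrix.GeneralLinearGroup.scalar (Fin 3) u : GL (Fin 3) ℂ) :
        Matrix (Fin 3) (Fin 3) ℂ) =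
          Matrix.GeneralLinearGroup.map Complex.ofRealHom (conjGL a b x) := congrArg Units.val hu
    have hu' := fun r s => congrFun (congrFun hum r) s
    simp only [Matrix.GeneralLinearGroup.coe_scalar, coe_GL_map, coe_conjGL, Matrix.map_apply,
      Matrix.scalar_apply, Matrix.diagonal_apply] at hu'
    refine ⟨conjMatrix (x : ℍ[ℝ, a, 0, b]) 0 0, ?_⟩
    ext r s
    apply Complex.ofReal_injective
    have h0 := hu' 0 0
    have hrs := hu' r s
    rw [if_pos rfl] at h0
    rw [h0] at hrs
    simp only [Complex.ofRealHom_eq_coe] at hrs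
    rw [← hrs, Matrix.smul_apply, Matrix.one_apply]
    split_ifs <;> simp
  · rintro ⟨t, ht⟩
    have ht0 : t ≠ 0 := by
      rintro rfl
      have := det_conjMatrix (x : ℍ[ℝ, a, 0, b])
      rw [ht, reducedNorm_coe_unitary] at this
      simp at this
    refine ⟨Units.mk0 (t : ℂ) (by exact_mod_cast ht0), Units.ext ?_⟩
    rw [coe_GL_map, coe_conjGL, ht, Matrix.GeneralLinearGroup.coe_scalar]
    ext r s
    simp [Matrix.diagonal_apply, Matrix.one_apply]
    split_ifs <;> simp

/-! ### Imaginary quadratic fields -/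

section ImaginaryQuadratic

variable {K : Type*} [Field K] [NumberField K] [NumberField.IsTotallyComplex K]

theorem univ_embeddings_eq_pair [DecidableEq (K →ₐ[ℚ] ℂ)] (hK : Module.finrank ℚ K = 2)
    (σ : K →+* ℂ) :
    (Finset.univ : Finset (K →ₐ[ℚ] ℂ)) =
      {σ.toRatAlgHom, ((starRingEnd ℂ).comp σ).toRatAlgHom} ∧
      σ.toRatAlgHom ≠ ((starRingEnd ℂ).comp σ).toRatAlgHom := by
  have hne : σ.toRatAlgHom ≠ ((starRingEnd ℂ).comp σ).toRatAlgHom := fun h => by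
    refine NumberField.IsTotallyComplex.complexEmbedding_not_isReal σ ?_
    rw [NumberField.ComplexEmbedding.isReal_iff]
    ext x
    exact (DFunLike.congr_fun h x).symm
  refine ⟨(Finset.eq_of_subset_of_card_le (Finset.subset_univ _) ?_).symm, hne⟩
  rw [Finset.card_pair hne, Finset.card_univ, AlgHom.card, hK]

theorem trace_eq_add_conj (hK : Module.finrank ℚ K = 2) (σ : K →+* ℂ) (w : 𝓞 K) :
    ((Algebra.trace ℤ (𝓞 K) w : ℤ) : ℂ) = σ w + conj (σ w) := by
  classical
  obtain ⟨hu, hne⟩ := univ_embeddings_eq_pair hK σ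
  have h := trace_eq_sum_embeddings (K := ℚ) (L := K) ℂ (x := (w : K))
  rw [hu, Finset.sum_pair hne, ← Algebra.coe_trace_int] at h
  simpa using h

theorem norm_eq_mul_conj (hK : Module.finrank ℚ K = 2) (σ : K →+* ℂ) (w : 𝓞 K) :
    ((Algebra.norm ℤ w : ℤ) : ℂ) = σ w * conj (σ w) := by
  classical
  obtain ⟨hu, hne⟩ := univ_embeddings_eq_pair hK σ
  have h := Algebra.norm_eq_prod_embeddings ℚ ℂ (w : K)
  rw [hu, Finset.prod_pair hne, ← Algebra.coe_norm_int] at h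
  simpa using h

/-- The ring of integers contains a purely imaginary square root of the discriminant. -/
theorem exists_sq_eq_discr (hK : Module.finrank ℚ K = 2) (σ : K →+* ℂ) :
    ∃ δ : 𝓞 K, conj (σ δ) = -σ δ ∧ σ δ ^ 2 = (NumberField.discr K : ℂ) := by
  have hcard : Module.finrank ℤ (𝓞 K) = 2 := by rw [NumberField.RingOfIntegers.rank, hK]
  let B : Module.Basis (Fin 2) ℤ (𝓞 K) := Module.finBasisOfFinrankEq ℤ (𝓞 K) hcard
  have hconj : ∀ w : 𝓞 K, conj (σ w) = (Algebra.trace ℤ (𝓞 K) w : ℤ) - σ w := fun w => by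
    rw [trace_eq_add_conj hK σ]; ring
  -- This is `δ = B₀ B̄₁ - B̄₀ B₁`, with conjugates written as trace minus element. Up to sign it is
  -- the determinant of the embeddings of an integral basis, whose square is the discriminant.
  refine ⟨B 0 * (algebraMap ℤ (𝓞 K) (Algebra.trace ℤ (𝓞 K) (B 1)) - B 1) -
    (algebraMap ℤ (𝓞 K) (Algebra.trace ℤ (𝓞 K) (B 0)) - B 0) * B 1, ?_, ?_⟩
  · simp
    rw [hconj, hconj]; ring
  · have hd : ((NumberField.discr K : ℤ) : ℂ) = (Algebra.discr ℤ B : ℤ) := by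
      rw [NumberField.discr_eq_discr]
    rw [hd, Algebra.discr_def, Matrix.det_fin_two]
    simp only [Algebra.traceMatrix_apply, Algebra.traceForm_apply]
    push_cast
    rw [trace_eq_add_conj hK σ (B 0 * B 0), trace_eq_add_conj hK σ (B 1 * B 1),
      trace_eq_add_conj hK σ (B 0 * B 1), trace_eq_add_conj hK σ (B 1 * B 0)]
    simp
    rw [hconj, hconj]
    ring

theorem discr_neg (hK : Module.finrank ℚ K = 2) (σ : K →+* ℂ) : NumberField.discr K < 0 := by
  obtain ⟨δ, h1, h2⟩ := exists_sq_eq_discr hK σ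
  have h3 : ((NumberField.discr K : ℤ) : ℂ) = -(Complex.normSq (σ δ) : ℂ) := by
    rw [← Complex.mul_conj, h1, ← h2]; ring
  have h4 : ((NumberField.discr K : ℤ) : ℝ) = -Complex.normSq (σ δ) := by exact_mod_cast h3
  have h5 : ((NumberField.discr K : ℤ) : ℝ) ≤ 0 := by
    rw [h4]; exact neg_nonpos.mpr (Complex.normSq_nonneg _)
  exact lt_of_le_of_ne (by exact_mod_cast h5) (NumberField.discr_ne_zero K)

theorem norm_pos_of_ne_zero (hK : Module.finrank ℚ K = 2) (σ : K →+* ℂ) {w : 𝓞 K} (hw : w ≠ 0) :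
    0 < Algebra.norm ℤ w := by
  have h : ((Algebra.norm ℤ w : ℤ) : ℝ) = Complex.normSq (σ w) := by
    have := norm_eq_mul_conj hK σ w
    rw [Complex.mul_conj] at this
    exact_mod_cast this
  have h2 : 0 < Complex.normSq (σ w) := Complex.normSq_pos.mpr (by simpa using hw)
  rw [← h] at h2
  exact_mod_cast h2

end ImaginaryQuadratic

/-! ### Isometries commuting with an antiholomorphic involution -/

section Frame

theorem mem_U12_iff {X : GL (Fin 3) ℂ} :
    X ∈ U12 ↔ (X : Matrix (Fin 3) (Fin 3) ℂ)ᴴ * hermMatrix * (X : Matrix (Fin 3) (Fin 3) ℂ) =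
      hermMatrix := Iff.rfl

theorem pureGram_map {R S : Type*} [CommRing R] [CommRing S] (f : R →+* S) (a b : R) :
    (pureGram a b).map f = pureGram (f a) (f b) := by
  ext r s; fin_cases r <;> fin_cases s <;> simp [pureGram]

/-- A matrix intertwined with an isometry of `h` by a similitude is an isometry. -/
theorem isometry_of_mul_eq_mul {J G : Matrix (Fin 3) (Fin 3) ℂ} {c : ℂ} (hc : c ≠ 0)
    {X P A : Matrix (Fin 3) (Fin 3) ℂ} (hP : Pᴴ * J * P = c • G) (hX : Xᴴ * J * X = J)
    (hXP : X * P = P * A) : Aᴴ * G * A = G := by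
  apply smul_right_injective _ hc
  calc c • (Aᴴ * G * A) = Aᴴ * (c • G) * A := by simp
    _ = (P * A)ᴴ * J * (P * A) := by
        rw [← hP, Matrix.conjTranspose_mul]; simp only [Matrix.mul_assoc]
    _ = Pᴴ * (Xᴴ * J * X) * P := by
        rw [← hXP, Matrix.conjTranspose_mul]; simp only [Matrix.mul_assoc]
    _ = c • G := by rw [hX, hP]

variable {P : GL (Fin 3) ℂ} {c : ℝ} {G : Matrix (Fin 3) (Fin 3) ℝ} {Y : GL (Fin 3) ℂ}

theorem frame_conj_mem_U12 (hc : 0 < c)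
    (hP : (P : Matrix (Fin 3) (Fin 3) ℂ)ᴴ * hermMatrix * (P : Matrix (Fin 3) (Fin 3) ℂ) =
      (c : ℂ) • G.map Complex.ofRealHom) {A : GL (Fin 3) ℝ}
    (hA : (A : Matrix (Fin 3) (Fin 3) ℝ)ᵀ * G * A = G) :
    P * Matrix.GeneralLinearGroup.map Complex.ofRealHom A * P⁻¹ ∈ U12 := by
  have hPi : ((P⁻¹ : GL (Fin 3) ℂ) : Matrix (Fin 3) (Fin 3) ℂ)ᴴ * G.map Complex.ofRealHom *
      ((P⁻¹ : GL (Fin 3) ℂ) : Matrix (Fin 3) (Fin 3) ℂ) = (c⁻¹ : ℂ) • hermMatrix := by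
    have h : (P : Matrix (Fin 3) (Fin 3) ℂ) * ((P⁻¹ : GL (Fin 3) ℂ) :
      Matrix (Fin 3) (Fin 3) ℂ) = 1 := P.mul_inv
    have hc' : (c : ℂ) ≠ 0 := by exact_mod_cast hc.ne'
    generalize ((P⁻¹ : GL (Fin 3) ℂ) : Matrix (Fin 3) (Fin 3) ℂ) = Q at h
    have hG : G.map Complex.ofRealHom = (c⁻¹ : ℂ) •
        ((P : Matrix (Fin 3) (Fin 3) ℂ)ᴴ * hermMatrix * (P : Matrix (Fin 3) (Fin 3) ℂ)) := by
      rw [hP, smul_smul, inv_mul_cancel₀ hc', one_smul]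
    calc Qᴴ * G.map Complex.ofRealHom * Q =
        (c⁻¹ : ℂ) • (((P : Matrix (Fin 3) (Fin 3) ℂ) * Q)ᴴ * hermMatrix *
          ((P : Matrix (Fin 3) (Fin 3) ℂ) * Q)) := by
          rw [hG, Matrix.conjTranspose_mul]; simp [Matrix.mul_assoc]
      _ = _ := by rw [h]; simp
  refine mem_U12_iff.mpr (isometry_of_mul_eq_mul (P := ((P⁻¹ : GL (Fin 3) ℂ) :
    Matrix (Fin 3) (Fin 3) ℂ)) (c := (c⁻¹ : ℂ)) (by simpa using hc.ne') hPi
    (ofReal_map_isometry_iff.mpr hA) ?_)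
  rw [← coe_GL_map, ← Units.val_mul, ← Units.val_mul]
  congr 1
  group

theorem real_conj_fixed (A : GL (Fin 3) ℝ) :
    Matrix.GeneralLinearGroup.map (starRingEnd ℂ)
      (Matrix.GeneralLinearGroup.map Complex.ofRealHom A) =
      Matrix.GeneralLinearGroup.map Complex.ofRealHom A := by
  ext r s; simp

theorem frame_conj_twisted (hY : Y * Matrix.GeneralLinearGroup.map (starRingEnd ℂ) P = P)
    (A : GL (Fin 3) ℝ) :
    P * Matrix.GeneralLinearGroup.map Complex.ofRealHom A * P⁻¹ * Y =
      Y * Matrix.GeneralLinearGroup.map (starRingEnd ℂ)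
        (P * Matrix.GeneralLinearGroup.map Complex.ofRealHom A * P⁻¹) := by
  have h : Matrix.GeneralLinearGroup.map (starRingEnd ℂ) P = Y⁻¹ * P := by
    rw [eq_inv_mul_iff_mul_eq, hY]
  rw [map_mul, map_mul, map_inv, real_conj_fixed, h]
  group

/-- The columns of `P` are fixed by `z ↦ Y z̄`, that is `P̄ = Y⁻¹P`. Commuting with this involution
therefore means that `P⁻¹XP` equals its complex conjugate. -/
theorem exists_real_of_twisted (hc : 0 < c)
    (hP : (P : Matrix (Fin 3) (Fin 3) ℂ)ᴴ * hermMatrix * (P : Matrix (Fin 3) (Fin 3) ℂ) =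
      (c : ℂ) • G.map Complex.ofRealHom)
    (hY : Y * Matrix.GeneralLinearGroup.map (starRingEnd ℂ) P = P) {X : GL (Fin 3) ℂ}
    (hX : X ∈ U12) (hXY : X * Y = Y * Matrix.GeneralLinearGroup.map (starRingEnd ℂ) X) :
    ∃ A : GL (Fin 3) ℝ, (A : Matrix (Fin 3) (Fin 3) ℝ)ᵀ * G * A = G ∧
      P * Matrix.GeneralLinearGroup.map Complex.ofRealHom A * P⁻¹ = X := by
  have h : Matrix.GeneralLinearGroup.map (starRingEnd ℂ) P = Y⁻¹ * P := by
    rw [eq_inv_mul_iff_mul_eq, hY]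
  have h' : Matrix.GeneralLinearGroup.map (starRingEnd ℂ) X = Y⁻¹ * X * Y := by
    rw [mul_assoc, eq_inv_mul_iff_mul_eq, hXY]
  have hfix : Matrix.GeneralLinearGroup.map (starRingEnd ℂ) (P⁻¹ * X * P) = P⁻¹ * X * P := by
    rw [map_mul, map_mul, map_inv, h, h']; group
  have hre : (((P⁻¹ * X * P : GL (Fin 3) ℂ) : Matrix (Fin 3) (Fin 3) ℂ).map Complex.re).map
      Complex.ofRealHom = ((P⁻¹ * X * P : GL (Fin 3) ℂ) : Matrix (Fin 3) (Fin 3) ℂ) := by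
    ext r s
    have hval : ((Matrix.GeneralLinearGroup.map (starRingEnd ℂ) (P⁻¹ * X * P) : GL (Fin 3) ℂ) :
        Matrix (Fin 3) (Fin 3) ℂ) = (P⁻¹ * X * P : GL (Fin 3) ℂ) := congrArg Units.val hfix
    have := congrFun (congrFun hval r) s
    rw [Matrix.map_apply, Matrix.map_apply]
    exact Complex.conj_eq_iff_re.mp this
  have hdet : (((P⁻¹ * X * P : GL (Fin 3) ℂ) : Matrix (Fin 3) (Fin 3) ℂ).map Complex.re).det ≠ 0 :=
    fun h0 => by
    have h1 := RingHom.map_det Complex.ofRealHom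
      (((P⁻¹ * X * P : GL (Fin 3) ℂ) : Matrix (Fin 3) (Fin 3) ℂ).map Complex.re)
    rw [h0, map_zero, RingHom.mapMatrix_apply, hre] at h1
    exact (P⁻¹ * X * P).det.ne_zero h1.symm
  have hA : Matrix.GeneralLinearGroup.map Complex.ofRealHom
      (Matrix.GeneralLinearGroup.mkOfDetNeZero _ hdet) = P⁻¹ * X * P := Units.ext hre
  refine ⟨Matrix.GeneralLinearGroup.mkOfDetNeZero _ hdet, ?_, by rw [hA]; group⟩
  rw [← ofReal_map_isometry_iff, ← coe_GL_map, hA]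
  refine isometry_of_mul_eq_mul (by exact_mod_cast hc.ne') hP (mem_U12_iff.mp hX) ?_
  rw [← Units.val_mul, ← Units.val_mul]
  congr 1
  group

theorem coe_mul_scalar {n R : Type*} [Fintype n] [DecidableEq n] [CommRing R] (X : GL n R)
    (u : Rˣ) : ((X * Matrix.GeneralLinearGroup.scalar n u : GL n R) : Matrix n n R) =
      (u : R) • (X : Matrix n n R) := by
  rw [Units.val_mul, Matrix.GeneralLinearGroup.coe_scalar, Matrix.scalar_apply,
    ← Matrix.smul_one_eq_diagonal, Matrix.mul_smul, Matrix.mul_one]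

theorem smul_isometry {X : Matrix (Fin 3) (Fin 3) ℂ} {J : Matrix (Fin 3) (Fin 3) ℂ} (u : ℂ) :
    (u • X)ᴴ * J * (u • X) = (Complex.normSq u : ℂ) • (Xᴴ * J * X) := by
  rw [Matrix.conjTranspose_smul, Matrix.smul_mul, Matrix.smul_mul, Matrix.mul_smul, smul_smul,
    ← Complex.mul_conj, mul_comm]
  rfl

theorem hermMatrix_apply_one_one : hermMatrix 1 1 = 1 := by simp [hermMatrix]

theorem normSq_eq_one_of_smul_mem_U12 {X X' : GL (Fin 3) ℂ} {u : ℂ} (hX : X ∈ U12)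
    (hX' : X' ∈ U12)
    (h : (X' : Matrix (Fin 3) (Fin 3) ℂ) = u • (X : Matrix (Fin 3) (Fin 3) ℂ)) :
    Complex.normSq u = 1 := by
  rw [mem_U12_iff] at hX hX'
  rw [h, smul_isometry, hX] at hX'
  have := congrFun (congrFun hX' 1) 1
  rw [Matrix.smul_apply, hermMatrix_apply_one_one] at this
  simpa using this

theorem conj_mem_U12 {X : GL (Fin 3) ℂ} (hX : X ∈ U12) :
    Matrix.GeneralLinearGroup.map (starRingEnd ℂ) X ∈ U12 := by
  rw [mem_U12_iff] at hX ⊢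
  have h : hermMatrix.map (starRingEnd ℂ) = hermMatrix := by
    ext r s; fin_cases r <;> fin_cases s <;> simp [hermMatrix, map_ofNat]
  have h2 := congrArg (fun M => M.map (starRingEnd ℂ)) hX
  simp only [Matrix.map_mul, h] at h2
  rw [coe_GL_map]
  exact h2

theorem YMatrix_mem_U12 (D : ℂ) (hD : D ≠ 0) : YMatrix D hD ∈ U12 := by
  have h : (starRingEnd ℂ) D ≠ 0 := by simpa using hD
  rw [mem_U12_iff]
  ext r s
  fin_cases r <;> fin_cases s <;>
    simp [YMatrix, hermMatrix, Matrix.mul_apply, Fin.sum_univ_three] <;> field_simp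

theorem exists_sq_eq_of_normSq_eq_one {u : ℂ} (hu : Complex.normSq u = 1) :
    ∃ v : ℂ, v ^ 2 = u ∧ Complex.normSq v = 1 := by
  obtain ⟨v, hv⟩ := IsAlgClosed.exists_pow_nat_eq u two_pos
  refine ⟨v, hv, ?_⟩
  rw [← hv, map_pow] at hu
  exact (pow_eq_one_iff_of_nonneg (Complex.normSq_nonneg v) two_ne_zero).mp hu

/-- A class in `PU(1,2)` stabilising `[Y]` has a representative in `U(1,2)` commuting with the
antiholomorphic involution `z ↦ Y z̄`. -/
theorem exists_representative_of_twisted (hYU : Y ∈ U12) {x : PGL(3, ℂ)} (hx : x ∈ PU12)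
    (hxY : x * Matrix.ProjGenLinGroup.mk Y * (pglConj x)⁻¹ = Matrix.ProjGenLinGroup.mk Y) :
    ∃ X ∈ U12, Matrix.ProjGenLinGroup.mk X = x ∧
      X * Y = Y * Matrix.GeneralLinearGroup.map (starRingEnd ℂ) X := by
  obtain ⟨X, hX, rfl⟩ := hx
  rw [mul_inv_eq_iff_eq_mul, pglConj, Matrix.ProjGenLinGroup.map_mk, ← map_mul, ← map_mul,
    Matrix.ProjGenLinGroup.mk_eq_mk_iff] at hxY
  obtain ⟨u, hu⟩ := hxY
  have hu' := congrArg Units.val hu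
  rw [coe_mul_scalar] at hu'
  have hu1 := normSq_eq_one_of_smul_mem_U12 (U12.mul_mem hX hYU)
    (U12.mul_mem hYU (conj_mem_U12 hX)) hu'.symm
  -- From `Y X̄ = u X Y` with `|u| = 1`, replacing `X` by `vX` where `v² = u` removes the scalar,
  -- since `v̄ u = v`.
  obtain ⟨v, hv, hv1⟩ := exists_sq_eq_of_normSq_eq_one hu1
  have hv0 : v ≠ 0 := by rintro rfl; simp at hv1
  have hvv : v = conj v * u := by
    rw [← hv, sq, ← mul_assoc, mul_comm (conj v), Complex.mul_conj, hv1]; simp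
  refine ⟨X * Matrix.GeneralLinearGroup.scalar (Fin 3) (Units.mk0 v hv0), ?_, by simp, ?_⟩
  · rw [mem_U12_iff, coe_mul_scalar, smul_isometry, Units.val_mk0, hv1, mem_U12_iff.mp hX]
    simp
  · apply Units.ext
    have hmap : ((Matrix.GeneralLinearGroup.map (starRingEnd ℂ)
        (X * Matrix.GeneralLinearGroup.scalar (Fin 3) (Units.mk0 v hv0)) : GL (Fin 3) ℂ) :
        Matrix (Fin 3) (Fin 3) ℂ) =
        conj v • (X : Matrix (Fin 3) (Fin 3) ℂ).map (starRingEnd ℂ) := by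
      rw [coe_GL_map, coe_mul_scalar]
      ext r s
      simp
    rw [Units.val_mul, Units.val_mul Y, hmap, coe_mul_scalar, Matrix.smul_mul, Matrix.mul_smul,
      Units.val_mk0]
    rw [Units.val_mul, Units.val_mul, coe_GL_map] at hu'
    rw [← hu', smul_smul, ← hvv]

/-- The matrix `P T⁻¹` multiplies `h` by `c`, so dividing it by `√c` gives a unitary representative
of the same class. -/
theorem similitude_frame_mem_PU12 (hc : 0 < c)
    (hP : (P : Matrix (Fin 3) (Fin 3) ℂ)ᴴ * hermMatrix * (P : Matrix (Fin 3) (Fin 3) ℂ) =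
      (c : ℂ) • G.map Complex.ofRealHom) {T : GL (Fin 3) ℝ}
    (hT : (T : Matrix (Fin 3) (Fin 3) ℝ)ᵀ * realFormMatrix * T = G) :
    Matrix.ProjGenLinGroup.mk (P * (Matrix.GeneralLinearGroup.map Complex.ofRealHom T)⁻¹) ∈
      PU12 := by
  have hs : (√c)⁻¹ ≠ 0 := inv_ne_zero (Real.sqrt_pos.mpr hc).ne'
  have hs' : (((√c)⁻¹ : ℝ) : ℂ) ≠ 0 := by exact_mod_cast hs
  refine ⟨P * (Matrix.GeneralLinearGroup.map Complex.ofRealHom T)⁻¹ *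
    Matrix.GeneralLinearGroup.scalar (Fin 3) (Units.mk0 _ hs'), ?_, by simp⟩
  have hn : Complex.normSq (((√c)⁻¹ : ℝ) : ℂ) * c = 1 := by
    rw [Complex.normSq_ofReal, ← mul_inv, Real.mul_self_sqrt hc.le, inv_mul_cancel₀ hc.ne']
  have h : ((Matrix.GeneralLinearGroup.map Complex.ofRealHom T : GL (Fin 3) ℂ) :
      Matrix (Fin 3) (Fin 3) ℂ) * (((Matrix.GeneralLinearGroup.map Complex.ofRealHom T)⁻¹ :
      GL (Fin 3) ℂ) : Matrix (Fin 3) (Fin 3) ℂ) = 1 := Units.mul_inv _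
  have hTc := ofReal_map_isometry_iff.mpr hT
  rw [realFormMatrix_map, ← coe_GL_map] at hTc
  change _ * _ * _ = _
  rw [coe_mul_scalar, smul_isometry, Units.val_mul, Units.val_mk0, Matrix.conjTranspose_mul]
  generalize (((Matrix.GeneralLinearGroup.map Complex.ofRealHom T)⁻¹ :
      GL (Fin 3) ℂ) : Matrix (Fin 3) (Fin 3) ℂ) = Q at h
  generalize ((Matrix.GeneralLinearGroup.map Complex.ofRealHom T : GL (Fin 3) ℂ) :
      Matrix (Fin 3) (Fin 3) ℂ) = T' at h hTc
  have h2 : Qᴴ * (P : Matrix (Fin 3) (Fin 3) ℂ)ᴴ * hermMatrix *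
      ((P : Matrix (Fin 3) (Fin 3) ℂ) * Q) = (c : ℂ) • hermMatrix := by
    calc _ = Qᴴ * ((P : Matrix (Fin 3) (Fin 3) ℂ)ᴴ * hermMatrix *
          (P : Matrix (Fin 3) (Fin 3) ℂ)) * Q := by simp only [Matrix.mul_assoc]
      _ = (c : ℂ) • ((T' * Q)ᴴ * hermMatrix * (T' * Q)) := by
        rw [hP, ← hTc, Matrix.conjTranspose_mul]; simp [Matrix.mul_assoc]
      _ = _ := by rw [h]; simp
  rw [h2, smul_smul, ← Complex.ofReal_mul, hn, Complex.ofReal_one, one_smul]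

end Frame

/-! ### Congruence subgroups -/

section Congruence

/-- If the images of the elements of `L` in the kernel of a homomorphism to a finite group lie in
`H`, then `H` has finite relative index in the image of `L`. -/
theorem relIndex_map_ne_zero_of_finite {G G' S : Type*} [Group G] [Group G'] [Group S] [Finite S]
    (H : Subgroup G) (L : Subgroup G') (φ : G' →* G) (ψ : G' →* S)
    (h : ∀ x ∈ L, ψ x = 1 → φ x ∈ H) : H.relIndex (L.map φ) ≠ 0 := by
  rw [← Subgroup.relIndex_comap]
  intro h0
  have hle : L ⊓ ψ.ker ≤ H.comap φ := fun x hx => h x hx.1 hx.2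
  have h1 := Subgroup.relIndex_eq_zero_of_le_left hle h0
  rw [Subgroup.inf_relIndex_left, Subgroup.relIndex_ker] at h1
  exact Nat.card_pos.ne' h1

variable {R : Type*} [CommRing R]

theorem map_one_add_smul {S : Type*} [CommRing S] (f : R →+* S) (n : R)
    (C : Matrix (Fin 3) (Fin 3) R) : (1 + n • C).map f = 1 + f n • C.map f := by
  ext i j
  rw [Matrix.map_apply, Matrix.add_apply, Matrix.add_apply, Matrix.smul_apply, Matrix.smul_apply,
    Matrix.map_apply, map_add, smul_eq_mul, smul_eq_mul, map_mul, Matrix.one_apply,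
    Matrix.one_apply]
  split_ifs <;> simp

theorem exists_eq_one_add_smul_of_map_eq_one {S : Type*} [CommRing S] {f : R →+* S} {n : R}
    (hf : ∀ x, f x = 0 → n ∣ x) {X : Matrix (Fin 3) (Fin 3) R} (hX : X.map f = 1) :
    ∃ C : Matrix (Fin 3) (Fin 3) R, X = 1 + n • C := by
  have h : ∀ i j, ∃ c, X i j = (1 : Matrix (Fin 3) (Fin 3) R) i j + n * c := fun i j => by
    have hij := congrFun (congrFun hX i) j
    rw [Matrix.map_apply] at hij
    obtain ⟨c, hc⟩ := hf (X i j - (1 : Matrix (Fin 3) (Fin 3) R) i j) (by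
      rw [map_sub, hij, Matrix.one_apply, Matrix.one_apply]; split_ifs <;> simp)
    exact ⟨c, by rw [← hc]; ring⟩
  choose C hC using h
  exact ⟨Matrix.of C, by ext i j; simp [hC]⟩

/-- Conjugates of congruent-to-one matrices by a matrix whose determinant divides the modulus are
integral. -/
theorem exists_mul_eq_mul_one_add {Q : Matrix (Fin 3) (Fin 3) R} {d' n : R} (hd : Q.det * d' = n)
    (C : Matrix (Fin 3) (Fin 3) R) :
    ∃ Z : Matrix (Fin 3) (Fin 3) R, Z * Q = Q * (1 + n • C) := by
  refine ⟨1 + d' • (Q * C * Q.adjugate), ?_⟩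
  rw [Matrix.add_mul, Matrix.mul_add, Matrix.smul_mul, Matrix.mul_assoc _ Q.adjugate,
    Matrix.adjugate_mul, Matrix.mul_smul, Matrix.mul_smul, Matrix.mul_one, smul_smul, ← hd,
    mul_comm d', Matrix.one_mul, Matrix.mul_one]

theorem exists_one_add_mul_eq_mul {Q : Matrix (Fin 3) (Fin 3) R} {d' n : R} (hd : Q.det * d' = n)
    (m : R) (C : Matrix (Fin 3) (Fin 3) R) :
    ∃ E : Matrix (Fin 3) (Fin 3) R, (1 + (n * m) • C) * Q = Q * (1 + m • E) := by
  refine ⟨d' • (Q.adjugate * C * Q), ?_⟩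
  have h : Q * (Q.adjugate * C * Q) = Q.det • (C * Q) := by
    rw [← Matrix.mul_assoc, ← Matrix.mul_assoc, Matrix.mul_adjugate]; simp
  rw [Matrix.add_mul, Matrix.mul_add, Matrix.smul_mul, Matrix.mul_smul, Matrix.mul_smul, h,
    smul_smul, smul_smul, ← hd, Matrix.one_mul, Matrix.mul_one]
  congr 2
  ring

variable {s : R →+* ℂ}

theorem exists_eq_conj (hT : ∀ w, ∃ t : ℤ, s w + conj (s w) = t) (w : R) :
    ∃ w', s w' = conj (s w) := by
  obtain ⟨t, ht⟩ := hT w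
  exact ⟨t - w, by rw [map_sub, map_intCast, ← ht]; ring⟩

theorem normSq_eq_intCast (hN : ∀ w, ∃ n : ℤ, s w * conj (s w) = n) (w : R) :
    ∃ n : ℤ, Complex.normSq (s w) = n := by
  obtain ⟨n, hn⟩ := hN w
  rw [Complex.mul_conj] at hn
  exact ⟨n, by exact_mod_cast hn⟩

theorem normSq_eq_one_of_mul_eq_one (hN : ∀ w, ∃ n : ℤ, s w * conj (s w) = n) {w w' : R}
    (h : w * w' = 1) : Complex.normSq (s w) = 1 := by
  obtain ⟨n, hn⟩ := normSq_eq_intCast hN w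
  obtain ⟨n', hn'⟩ := normSq_eq_intCast hN w'
  have h1 : (n : ℝ) * n' = 1 := by
    rw [← hn, ← hn', ← map_mul, ← map_mul, h, map_one, map_one]
  have h0 : (0 : ℝ) ≤ n := hn ▸ Complex.normSq_nonneg _
  have h2 : n * n' = 1 := by exact_mod_cast h1
  have h3 : 0 ≤ n := by exact_mod_cast h0
  rcases Int.isUnit_iff.mp (IsUnit.of_mul_eq_one _ h2) with h | h
  · rw [hn, h]; simp
  · omega

/-- Two points of the unit circle are at distance at most `2 < M`. Hence `v` has absolute value less
than one, and its norm, being an integer, is 0. -/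
theorem eq_one_of_normSq_eq_one_of_congr (hs : Function.Injective s)
    (hN : ∀ w, ∃ n : ℤ, s w * conj (s w) = n) {w v : R} {M : ℤ} (hM : 2 < M)
    (hw : Complex.normSq (s w) = 1) (hv : w = 1 + M * v) : w = 1 := by
  obtain ⟨n, hn⟩ := normSq_eq_intCast hN v
  have h1 : ‖s w‖ = 1 := by
    rw [Complex.normSq_eq_norm_sq] at hw
    exact (pow_eq_one_iff_of_nonneg (norm_nonneg _) two_ne_zero).mp hw
  have h2 : ‖(M : ℂ) * s v‖ ≤ 2 := by
    have : (M : ℂ) * s v = s w - 1 := by rw [hv]; simp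
    rw [this]
    refine (norm_sub_le _ _).trans ?_
    rw [h1, norm_one]; norm_num
  rw [norm_mul, Complex.norm_intCast] at h2
  have h3 : (M : ℝ) ^ 2 * n ≤ 4 := by
    rw [← hn, Complex.normSq_eq_norm_sq, ← sq_abs (M : ℝ), ← mul_pow]
    nlinarith [mul_nonneg (abs_nonneg (M : ℝ)) (norm_nonneg (s v))]
  have h4 : M ^ 2 * n ≤ 4 := by exact_mod_cast h3
  have h5 : n ≤ 0 := by by_contra! h; nlinarith
  have h6 : Complex.normSq (s v) = 0 := le_antisymm (by rw [hn]; exact_mod_cast h5)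
    (Complex.normSq_nonneg _)
  have h7 : v = 0 := hs (by rw [map_zero]; exact Complex.normSq_eq_zero.mp h6)
  rw [hv, h7, mul_zero, add_zero]

/-- If `u ≠ 1` then `u² + u + 1 = 0`, so `g² + gḡ + ḡ² = 0`. The left side is 3 modulo `M`, so `M`
divides 3 in `R`; taking norms, `M²` divides 9, which is impossible for `M > 3`. -/
theorem eq_one_of_pow_three_eq_one_of_congr (hs : Function.Injective s)
    (hN : ∀ w, ∃ n : ℤ, s w * conj (s w) = n) (hT : ∀ w, ∃ t : ℤ, s w + conj (s w) = t)
    {g v : R} {M : ℤ} (hM : 3 < M) (hv : g = 1 + M * v) {u : ℂ} (hu : u ^ 3 = 1)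
    (hug : u * s g = conj (s g)) : u = 1 := by
  obtain ⟨v', hv'⟩ := exists_eq_conj hT v
  have hsg : s g = 1 + M * s v := by rw [hv]; simp
  have hsg' : conj (s g) = 1 + M * s v' := by rw [hsg, hv']; simp
  by_cases hu1 : u = 1
  · exact hu1
  exfalso
  have hu2 : u ^ 2 + u + 1 = 0 := mul_left_cancel₀ (sub_ne_zero.mpr hu1) (by linear_combination hu)
  have h0 : s g ^ 2 + s g * conj (s g) + conj (s g) ^ 2 = 0 := by
    rw [← hug]; linear_combination s g ^ 2 * hu2
  obtain ⟨z, hz⟩ : ∃ z : R, (M : R) * z = 3 := by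
    refine ⟨-(2 * v + v' + v + 2 * v' + M * v ^ 2 + M * v * v' + M * v' ^ 2), hs ?_⟩
    rw [hsg', hsg] at h0
    simp only [map_mul, map_neg, map_add, map_intCast, map_pow, map_ofNat]
    linear_combination -h0
  obtain ⟨n, hn⟩ := normSq_eq_intCast hN z
  have h9 : (M : ℝ) ^ 2 * n = 9 := by
    have := congrArg (fun x => Complex.normSq (s x)) hz
    simp only [map_mul, map_intCast, hn, map_ofNat] at this
    rw [Complex.normSq_intCast, Complex.normSq_ofNat] at this
    rw [sq, this]; norm_num
  have h9' : M ^ 2 * n = 9 := by exact_mod_cast h9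
  have hn0 : 0 < n := by by_contra! h; nlinarith
  nlinarith

end Congruence

/-! ### The stabiliser and the integral quaternions of norm one -/

section Commensurable

/-- The action of the integral quaternions of norm one, in the frame `P`. -/
noncomputable def integralFrameHom (P : GL (Fin 3) ℂ) (a b : ℤ) :
    unitary ℍ[ℤ, a, 0, b] →* PGL(3, ℂ) :=
  (frameHom P).comp ((Matrix.GeneralLinearGroup.map (Int.castRingHom ℝ)).comp (conjGL a b))

theorem map_integralNormOne (P : GL (Fin 3) ℂ) (a b : ℤ) :
    (integralNormOne a b).map ((frameHom P).comp (conjGL (a : ℝ) (b : ℝ))) =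
      (⊤ : Subgroup (unitary ℍ[ℤ, a, 0, b])).map (integralFrameHom P a b) := by
  have key : ∀ (x : unitary ℍ[ℝ, (a : ℝ), 0, (b : ℝ)]) (y : unitary ℍ[ℤ, a, 0, b]),
      (x : ℍ[ℝ, (a : ℝ), 0, (b : ℝ)]) = ⟨(y : ℍ[ℤ, a, 0, b]).re, (y : ℍ[ℤ, a, 0, b]).imI,
        (y : ℍ[ℤ, a, 0, b]).imJ, (y : ℍ[ℤ, a, 0, b]).imK⟩ →
      (frameHom P).comp (conjGL (a : ℝ) (b : ℝ)) x = integralFrameHom P a b y := fun x y hxy => by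
    refine congrArg (frameHom P) (Units.ext ?_)
    rw [coe_conjGL, hxy]
    exact (conjMatrix_map (Int.castRingHom ℝ) (y : ℍ[ℤ, a, 0, b])).symm
  have hnorm : ∀ y : ℍ[ℤ, a, 0, b],
      reducedNorm (⟨y.re, y.imI, y.imJ, y.imK⟩ : ℍ[ℝ, (a : ℝ), 0, (b : ℝ)]) =
        (reducedNorm y : ℤ) := fun y => by simp [reducedNorm]
  ext z
  constructor
  · rintro ⟨x, ⟨y, hy⟩, rfl⟩
    have hy1 : reducedNorm y = 1 := by
      have := reducedNorm_coe_unitary x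
      rw [hy, hnorm] at this
      exact_mod_cast this
    exact ⟨⟨y, mem_unitary_iff_reducedNorm.mpr hy1⟩, trivial, (key _ _ hy).symm⟩
  · rintro ⟨y, -, rfl⟩
    have hy1 : reducedNorm (⟨(y : ℍ[ℤ, a, 0, b]).re, (y : ℍ[ℤ, a, 0, b]).imI,
        (y : ℍ[ℤ, a, 0, b]).imJ, (y : ℍ[ℤ, a, 0, b]).imK⟩ : ℍ[ℝ, (a : ℝ), 0, (b : ℝ)]) = 1 := by
      rw [hnorm, reducedNorm_coe_unitary]; simp
    exact ⟨⟨_, mem_unitary_iff_reducedNorm.mpr hy1⟩, ⟨_, rfl⟩, key _ _ rfl⟩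

variable {R : Type*} [CommRing R] {s : R →+* ℂ} {a b : ℤ} {c : ℝ} {P Y : GL (Fin 3) ℂ}
  {Q : Matrix (Fin 3) (Fin 3) R}

theorem det_frame_ne_zero (hPQ : (P : Matrix (Fin 3) (Fin 3) ℂ) = Q.map s) : s Q.det ≠ 0 := by
  rw [RingHom.map_det, RingHom.mapMatrix_apply, ← hPQ]
  exact P.det.ne_zero

theorem exists_modulus (hN : ∀ w, ∃ n : ℤ, s w * conj (s w) = n)
    (hT : ∀ w, ∃ t : ℤ, s w + conj (s w) = t) (hs : Function.Injective s)
    (hPQ : (P : Matrix (Fin 3) (Fin 3) ℂ) = Q.map s) :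
    ∃ (n : ℕ) (d' : R), 0 < n ∧ Q.det * d' = n := by
  obtain ⟨d', hd'⟩ := exists_eq_conj hT Q.det
  obtain ⟨n, hn⟩ := normSq_eq_intCast hN Q.det
  have hpos : 0 < n := by
    have := Complex.normSq_pos.mpr (det_frame_ne_zero hPQ)
    rw [hn] at this
    exact_mod_cast this
  lift n to ℕ using hpos.le
  -- The modulus `n` is the norm of `det Q`, and the cofactor `d'` is its conjugate.
  refine ⟨n, d', by exact_mod_cast hpos, hs ?_⟩
  rw [map_mul, hd', Complex.mul_conj, hn]
  simp

theorem isometry_intCast (q : unitary ℍ[ℤ, a, 0, b]) :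
    ((Matrix.GeneralLinearGroup.map (Int.castRingHom ℝ) (conjGL a b q) : GL (Fin 3) ℝ) :
        Matrix (Fin 3) (Fin 3) ℝ)ᵀ * pureGram (a : ℝ) b *
      (Matrix.GeneralLinearGroup.map (Int.castRingHom ℝ) (conjGL a b q) : GL (Fin 3) ℝ) =
        pureGram (a : ℝ) b := by
  have hG : pureGram (a : ℝ) b = (pureGram a b).map (Int.castRingHom ℝ) := by
    rw [pureGram_map]; rfl
  rw [coe_GL_map, coe_conjGL, hG, ← Matrix.transpose_map, ← Matrix.map_mul, ← Matrix.map_mul,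
    conjMatrix_transpose_mul_pureGram_mul, reducedNorm_coe_unitary, one_pow, one_smul]

/-- A subgroup of finite index of the integral quaternions of norm one acts integrally. -/
theorem relIndex_integral_ne_zero (hN : ∀ w, ∃ n : ℤ, s w * conj (s w) = n)
    (hT : ∀ w, ∃ t : ℤ, s w + conj (s w) = t) (hs : Function.Injective s) (hc : 0 < c)
    (hPQ : (P : Matrix (Fin 3) (Fin 3) ℂ) = Q.map s)
    (hP : (P : Matrix (Fin 3) (Fin 3) ℂ)ᴴ * hermMatrix * (P : Matrix (Fin 3) (Fin 3) ℂ) =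
      (c : ℂ) • (pureGram (a : ℝ) b).map Complex.ofRealHom)
    (hY : Y * Matrix.GeneralLinearGroup.map (starRingEnd ℂ) P = P) :
    (twistedStabilizer (PU12 ⊓ (Matrix.ProjGenLinGroup.map (n := Fin 3) s).range)
      (Matrix.ProjGenLinGroup.mk Y)).relIndex
      ((integralNormOne a b).map ((frameHom P).comp (conjGL (a : ℝ) (b : ℝ)))) ≠ 0 := by
  obtain ⟨n, d', hn, hd'⟩ := exists_modulus hN hT hs hPQ
  have : NeZero n := ⟨hn.ne'⟩
  have hfin : Finite (GL (Fin 3) (ZMod n)) := by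
    have : Finite (Matrix (Fin 3) (Fin 3) (ZMod n)) :=
      inferInstanceAs (Finite (Fin 3 → Fin 3 → ZMod n))
    infer_instance
  rw [map_integralNormOne]
  refine relIndex_map_ne_zero_of_finite _ _ _
    ((Matrix.GeneralLinearGroup.map (Int.castRingHom (ZMod n))).comp (conjGL a b)) ?_
  intro q _ hq
  have hint : ∀ A : GL (Fin 3) ℤ, Matrix.GeneralLinearGroup.map (Int.castRingHom (ZMod n)) A = 1 →
      ∃ Z : Matrix (Fin 3) (Fin 3) R,
        Z * Q = Q * (A : Matrix (Fin 3) (Fin 3) ℤ).map (Int.castRingHom R) := fun A hA => by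
    have hA' : (A : Matrix (Fin 3) (Fin 3) ℤ).map (Int.castRingHom (ZMod n)) = 1 :=
      congrArg Units.val hA
    obtain ⟨C, hC⟩ := exists_eq_one_add_smul_of_map_eq_one (n := (n : ℤ))
      (fun x hx => (ZMod.intCast_zmod_eq_zero_iff_dvd x n).mp hx) hA'
    obtain ⟨Z, hZ⟩ := exists_mul_eq_mul_one_add hd' (C.map (Int.castRingHom R))
    refine ⟨Z, ?_⟩
    rw [hZ, hC, map_one_add_smul]
    simp
  have hcast : ∀ A : GL (Fin 3) ℤ, ((A : Matrix (Fin 3) (Fin 3) ℤ).map (Int.castRingHom R)).map s =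
      (Matrix.GeneralLinearGroup.map Complex.ofRealHom
        (Matrix.GeneralLinearGroup.map (Int.castRingHom ℝ) A) : GL (Fin 3) ℂ) := fun A => by
    ext i j
    simp
  have hconj : ∀ (A : GL (Fin 3) ℤ) (Z : Matrix (Fin 3) (Fin 3) R),
      Z * Q = Q * (A : Matrix (Fin 3) (Fin 3) ℤ).map (Int.castRingHom R) →
      Z.map s = (P * Matrix.GeneralLinearGroup.map Complex.ofRealHom
        (Matrix.GeneralLinearGroup.map (Int.castRingHom ℝ) A) * P⁻¹ : GL (Fin 3) ℂ) :=
    fun A Z hZ => by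
    have h1 := congrArg (fun M => M.map s) hZ
    simp only [Matrix.map_mul] at h1
    rw [hcast, ← hPQ] at h1
    rw [Units.val_mul, Units.val_mul, ← h1, Matrix.mul_assoc, ← Units.val_mul, mul_inv_cancel,
      Units.val_one, Matrix.mul_one]
  set A := conjGL a b q with hAdef
  obtain ⟨Z, hZ⟩ := hint A hq
  -- Integrality of the conjugate of `A⁻¹` as well makes `Z` invertible over `R`.
  obtain ⟨Z', hZ'⟩ := hint A⁻¹ (by rw [map_inv]; exact inv_eq_one.mpr hq)
  have hmapinj : Function.Injective fun M : Matrix (Fin 3) (Fin 3) R => M.map s :=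
    Matrix.map_injective hs
  have hZZ' : Z * Z' = 1 := hmapinj (by
    simp only [Matrix.map_mul]
    rw [hconj _ _ hZ, hconj _ _ hZ', ← Units.val_mul, map_inv, map_inv]
    rw [show ∀ B : GL (Fin 3) ℂ, P * B * P⁻¹ * (P * B⁻¹ * P⁻¹) = 1 from fun B => by group]
    simp)
  have hZ'Z : Z' * Z = 1 := hmapinj (by
    simp only [Matrix.map_mul]
    rw [hconj _ _ hZ, hconj _ _ hZ', ← Units.val_mul, map_inv, map_inv]
    rw [show ∀ B : GL (Fin 3) ℂ, P * B⁻¹ * P⁻¹ * (P * B * P⁻¹) = 1 from fun B => by group]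
    simp)
  have hval : Matrix.GeneralLinearGroup.map s (⟨Z, Z', hZZ', hZ'Z⟩ : GL (Fin 3) R) =
      P * Matrix.GeneralLinearGroup.map Complex.ofRealHom
        (Matrix.GeneralLinearGroup.map (Int.castRingHom ℝ) A) * P⁻¹ := Units.ext (hconj _ _ hZ)
  change frameHom P (Matrix.GeneralLinearGroup.map (Int.castRingHom ℝ) A) ∈ _
  rw [frameHom_apply]
  refine ⟨⟨⟨_, frame_conj_mem_U12 hc hP (isometry_intCast q), rfl⟩, ?_⟩, ?_⟩
  · rw [← hval]
    exact ⟨Matrix.ProjGenLinGroup.mk ⟨Z, Z', hZZ', hZ'Z⟩, rfl⟩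
  · rw [mul_inv_eq_iff_eq_mul, pglConj, Matrix.ProjGenLinGroup.map_mk, ← map_mul, ← map_mul,
      frame_conj_twisted hY]

/-- An element of `GL₃(R)` representing a class in `PU(1,2)` lies in `U(1,2)`. -/
theorem mem_U12_of_mk_mem_PU12 (hN : ∀ w, ∃ n : ℤ, s w * conj (s w) = n) {X : GL (Fin 3) R}
    (hX : Matrix.ProjGenLinGroup.mk (Matrix.GeneralLinearGroup.map s X) ∈ PU12) :
    Matrix.GeneralLinearGroup.map s X ∈ U12 := by
  obtain ⟨U, hU, hUX⟩ := hX
  obtain ⟨u, hu⟩ := Matrix.ProjGenLinGroup.mk_eq_mk_iff.mp hUX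
  have hu' := congrArg Units.val hu
  rw [coe_mul_scalar] at hu'
  have hdetX : Complex.normSq (s (X : Matrix (Fin 3) (Fin 3) R).det) = 1 :=
    normSq_eq_one_of_mul_eq_one hN (w' := ((X⁻¹ : GL (Fin 3) R) : Matrix (Fin 3) (Fin 3) R).det)
      (by rw [← Matrix.det_mul, ← Units.val_mul, mul_inv_cancel]; simp)
  have hdetU : Complex.normSq (U : Matrix (Fin 3) (Fin 3) ℂ).det = 1 := by
    have h := congrArg Matrix.det (mem_U12_iff.mp hU)
    have h0 : hermMatrix.det ≠ 0 := by
      simp [Matrix.det_fin_three, hermMatrix]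
    rw [Matrix.det_mul, Matrix.det_mul, Matrix.det_conjTranspose] at h
    have h2 : (Complex.normSq (U : Matrix (Fin 3) (Fin 3) ℂ).det : ℂ) = 1 := by
      rw [← Complex.mul_conj]
      exact mul_left_cancel₀ h0 (by
        rw [mul_one]; nth_rewrite 2 [← h]; rw [starRingEnd_apply]; ring)
    exact_mod_cast h2
  have hu1 : Complex.normSq (u : ℂ) = 1 := by
    have h := congrArg (fun M => Complex.normSq (Matrix.det M)) hu'
    simp only [Matrix.det_smul, map_mul, map_pow, hdetU, Fintype.card_fin, mul_one] at h
    rw [coe_GL_map, ← RingHom.mapMatrix_apply, ← RingHom.map_det, hdetX] at h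
    exact (pow_eq_one_iff_of_nonneg (Complex.normSq_nonneg _) three_ne_zero).mp h
  rw [mem_U12_iff, ← hu', smul_isometry, hu1, mem_U12_iff.mp hU]
  simp

/-- An integral matrix congruent to one whose class stabilises `[Y]` satisfies `X Y = Y X̄` and has
determinant one. -/
theorem twisted_of_congruence (hN : ∀ w, ∃ n : ℤ, s w * conj (s w) = n)
    (hT : ∀ w, ∃ t : ℤ, s w + conj (s w) = t) (hs : Function.Injective s) {M : ℤ} (hM : 3 < M)
    {X : GL (Fin 3) R} {C : Matrix (Fin 3) (Fin 3) R}
    (hXC : (X : Matrix (Fin 3) (Fin 3) R) = 1 + (M : R) • C)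
    (hYrow : ∀ j, (Y : Matrix (Fin 3) (Fin 3) ℂ) 1 j = (1 : Matrix (Fin 3) (Fin 3) ℂ) 1 j)
    (hYcol : ∀ i, (Y : Matrix (Fin 3) (Fin 3) ℂ) i 1 = (1 : Matrix (Fin 3) (Fin 3) ℂ) i 1)
    (hXY : Matrix.ProjGenLinGroup.mk (Matrix.GeneralLinearGroup.map s X) *
      Matrix.ProjGenLinGroup.mk Y *
      (pglConj (Matrix.ProjGenLinGroup.mk (Matrix.GeneralLinearGroup.map s X)))⁻¹ =
        Matrix.ProjGenLinGroup.mk Y) :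
    (X : Matrix (Fin 3) (Fin 3) R).det = 1 ∧ Matrix.GeneralLinearGroup.map s X * Y =
      Y * Matrix.GeneralLinearGroup.map (starRingEnd ℂ) (Matrix.GeneralLinearGroup.map s X) := by
  have hdet : (X : Matrix (Fin 3) (Fin 3) R).det = 1 := by
    obtain ⟨v, hv⟩ : ∃ v, (X : Matrix (Fin 3) (Fin 3) R).det = 1 + M * v := by
      have h : (Ideal.Quotient.mk (Ideal.span {(M : R)})) (X : Matrix (Fin 3) (Fin 3) R).det =
          1 := by
        rw [RingHom.map_det, RingHom.mapMatrix_apply]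
        have h1 : (X : Matrix (Fin 3) (Fin 3) R).map
            (Ideal.Quotient.mk (Ideal.span {(M : R)})) = 1 := by
          have h0 : (Ideal.Quotient.mk (Ideal.span {(M : R)})) (M : R) = 0 :=
            Ideal.Quotient.eq_zero_iff_mem.mpr (Ideal.mem_span_singleton_self _)
          rw [hXC, map_one_add_smul, h0, zero_smul, add_zero]
        rw [h1, Matrix.det_one]
      rw [← map_one (Ideal.Quotient.mk (Ideal.span {(M : R)})), Ideal.Quotient.eq,
        Ideal.mem_span_singleton] at h
      obtain ⟨v, hv⟩ := h
      exact ⟨v, by rw [← hv]; ring⟩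
    -- The determinant is a unit, hence of absolute value one, and it is congruent to 1 modulo `M`.
    refine eq_one_of_normSq_eq_one_of_congr hs hN (by omega) ?_ hv
    exact normSq_eq_one_of_mul_eq_one hN
      (w' := ((X⁻¹ : GL (Fin 3) R) : Matrix (Fin 3) (Fin 3) R).det)
      (by rw [← Matrix.det_mul, ← Units.val_mul, mul_inv_cancel]; simp)
  refine ⟨hdet, ?_⟩
  rw [mul_inv_eq_iff_eq_mul, pglConj, Matrix.ProjGenLinGroup.map_mk, ← map_mul, ← map_mul,
    Matrix.ProjGenLinGroup.mk_eq_mk_iff] at hXY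
  obtain ⟨u, hu⟩ := hXY
  have hu' := congrArg Units.val hu
  rw [coe_mul_scalar, Units.val_mul, Units.val_mul] at hu'
  have hdetXc : (Matrix.GeneralLinearGroup.map s X : Matrix (Fin 3) (Fin 3) ℂ).det = 1 := by
    rw [coe_GL_map, ← RingHom.mapMatrix_apply, ← RingHom.map_det, hdet, map_one]
  have hdetXc' : (Matrix.GeneralLinearGroup.map (starRingEnd ℂ) (Matrix.GeneralLinearGroup.map s X) :
      Matrix (Fin 3) (Fin 3) ℂ).det = 1 := by
    rw [coe_GL_map, ← RingHom.mapMatrix_apply, ← RingHom.map_det, hdetXc, map_one]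
  have hu3 : (u : ℂ) ^ 3 = 1 := by
    have h := congrArg Matrix.det hu'
    rw [Matrix.det_smul, Matrix.det_mul, Matrix.det_mul, hdetXc, hdetXc', one_mul, mul_one,
      Fintype.card_fin] at h
    exact mul_right_cancel₀ Y.det.ne_zero (h.trans (one_mul _).symm)
  -- The middle row and column of `Y` are those of the identity, so the middle entry of `X Y` and `Y
  -- X̄` is that of `X` and `X̄`.
  have hentry : (u : ℂ) * s ((X : Matrix (Fin 3) (Fin 3) R) 1 1) =
      conj (s ((X : Matrix (Fin 3) (Fin 3) R) 1 1)) := by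
    have h := congrFun (congrFun hu' 1) 1
    rw [Matrix.smul_apply, Matrix.mul_apply, Matrix.mul_apply] at h
    simp only [hYrow, hYcol] at h
    simpa [Matrix.one_apply] using h
  have hu1 := eq_one_of_pow_three_eq_one_of_congr hs hN hT hM
    (g := (X : Matrix (Fin 3) (Fin 3) R) 1 1) (v := C 1 1) (by rw [hXC]; simp) hu3 hentry
  rw [hu1, one_smul] at hu'
  exact Units.ext hu'

/-- A subgroup of finite index of the stabiliser comes from integral quaternions of norm one. -/
theorem relIndex_stabilizer_ne_zero [IsDomain R] [Ring.HasFiniteQuotients R]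
    (hN : ∀ w, ∃ n : ℤ, s w * conj (s w) = n)
    (hT : ∀ w, ∃ t : ℤ, s w + conj (s w) = t) (hs : Function.Injective s) (ha : a ≠ 0)
    (hb : b ≠ 0) (hc : 0 < c)
    (hPQ : (P : Matrix (Fin 3) (Fin 3) ℂ) = Q.map s)
    (hP : (P : Matrix (Fin 3) (Fin 3) ℂ)ᴴ * hermMatrix * (P : Matrix (Fin 3) (Fin 3) ℂ) =
      (c : ℂ) • (pureGram (a : ℝ) b).map Complex.ofRealHom)
    (hY : Y * Matrix.GeneralLinearGroup.map (starRingEnd ℂ) P = P)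
    (hYrow : ∀ j, (Y : Matrix (Fin 3) (Fin 3) ℂ) 1 j = (1 : Matrix (Fin 3) (Fin 3) ℂ) 1 j)
    (hYcol : ∀ i, (Y : Matrix (Fin 3) (Fin 3) ℂ) i 1 = (1 : Matrix (Fin 3) (Fin 3) ℂ) i 1) :
    ((integralNormOne a b).map ((frameHom P).comp (conjGL (a : ℝ) (b : ℝ)))).relIndex
      (twistedStabilizer (PU12 ⊓ (Matrix.ProjGenLinGroup.map (n := Fin 3) s).range)
        (Matrix.ProjGenLinGroup.mk Y)) ≠ 0 := by
  obtain ⟨n, d', hn, hd'⟩ := exists_modulus hN hT hs hPQ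
  set Γ := twistedStabilizer (PU12 ⊓ (Matrix.ProjGenLinGroup.map (n := Fin 3) s).range)
        (Matrix.ProjGenLinGroup.mk Y) with hΓ
  let φ : GL (Fin 3) R →* PGL(3, ℂ) :=
    Matrix.ProjGenLinGroup.mk.comp (Matrix.GeneralLinearGroup.map s)
  have hΓφ : (Γ.comap φ).map φ = Γ := by
    refine Subgroup.map_comap_eq_self ?_
    rintro x ⟨⟨-, ⟨y, hy⟩⟩, -⟩
    obtain ⟨X, rfl⟩ := Matrix.ProjGenLinGroup.mk_surjective y
    exact ⟨X, hy⟩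
  -- the factor `2` makes the coefficients integers, `|ab|` makes the modulus positive
  let m : ℤ := 2 * (16 * a * b)
  let M : ℤ := n * (m * (a * b))
  have hab : 0 < (a * b) ^ 2 := by positivity
  have hM : 3 < M := by
    have hn' : (1 : ℤ) ≤ n := by exact_mod_cast hn
    have : M = n * (32 * (a * b) ^ 2) := by simp only [M, m]; ring
    nlinarith
  let I : Ideal R := Ideal.span {(M : R)}
  have hMR : (M : R) ≠ 0 := fun h => by
    have h1 := congrArg s h
    rw [map_intCast, map_zero] at h1
    have : M = 0 := by exact_mod_cast h1
    omega
  have hfin : Finite (GL (Fin 3) (R ⧸ I)) := by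
    have : Finite (R ⧸ I) := Ring.HasFiniteQuotients.finiteQuotient
      (by rwa [Ne, Ideal.span_singleton_eq_bot])
    have : Finite (Matrix (Fin 3) (Fin 3) (R ⧸ I)) :=
      inferInstanceAs (Finite (Fin 3 → Fin 3 → R ⧸ I))
    infer_instance
  rw [← hΓφ]
  refine relIndex_map_ne_zero_of_finite _ _ _
    (Matrix.GeneralLinearGroup.map (Ideal.Quotient.mk I)) ?_
  intro X hX hX1
  rw [map_integralNormOne]
  obtain ⟨⟨hXU, -⟩, hXY⟩ : φ X ∈ Γ := hX
  have hX1' : (X : Matrix (Fin 3) (Fin 3) R).map (Ideal.Quotient.mk I) = 1 := congrArg Units.val hX1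
  obtain ⟨C, hC⟩ := exists_eq_one_add_smul_of_map_eq_one (n := (M : R)) (fun x hx =>
    Ideal.mem_span_singleton.mp (Ideal.Quotient.eq_zero_iff_mem.mp hx)) hX1'
  obtain ⟨hdet, htw⟩ := twisted_of_congruence hN hT hs hM hC hYrow hYcol hXY
  obtain ⟨A, hA, hAX⟩ := exists_real_of_twisted hc hP hY (mem_U12_of_mk_mem_PU12 hN hXU) htw
  -- Conjugation by `Q` costs the factor `n` of `M = n m ab`, so `Q⁻¹XQ` is still congruent to 1
  -- modulo `m`.
  obtain ⟨E, hE⟩ := exists_one_add_mul_eq_mul hd' (m : R) ((a * b : R) • C)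
  have hE' : (X : Matrix (Fin 3) (Fin 3) R) * Q = Q * (1 + (m : R) • E) := by
    rw [← hE, hC, smul_smul]
    congr 3
    simp only [M]
    push_cast
    ring
  -- the coefficients of `A` are rational integers
  have hAE : (A : Matrix (Fin 3) (Fin 3) ℝ).map Complex.ofRealHom =
      1 + (m : ℂ) • E.map s := by
    have h1 := congrArg (fun M => M.map s) hE'
    simp only [Matrix.map_mul] at h1
    rw [← hPQ] at h1
    have h2 : (X : Matrix (Fin 3) (Fin 3) R).map s * (P : Matrix (Fin 3) (Fin 3) ℂ) =
        (P : Matrix (Fin 3) (Fin 3) ℂ) * (A : Matrix (Fin 3) (Fin 3) ℝ).map Complex.ofRealHom := by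
      rw [← coe_GL_map, ← hAX, ← coe_GL_map, ← Units.val_mul, ← Units.val_mul]
      congr 1
      group
    rw [h2, map_one_add_smul, map_intCast] at h1
    have h4 : IsUnit (P : Matrix (Fin 3) (Fin 3) ℂ) := P.isUnit
    exact h4.mul_left_cancel h1
  choose t ht using hT
  let E' : Matrix (Fin 3) (Fin 3) ℤ := Matrix.of fun i j => t (E i j)
  have hmc : (m : ℂ) ≠ 0 := by
    have : m ≠ 0 := mul_ne_zero two_ne_zero (mul_ne_zero (mul_ne_zero (by norm_num) ha) hb)
    exact_mod_cast this
  have hAE' : (A : Matrix (Fin 3) (Fin 3) ℝ) =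
      (1 + (16 * a * b) • E').map (Int.castRingHom ℝ) := by
    ext i j
    apply Complex.ofReal_injective
    have h1 := congrFun (congrFun hAE i) j
    rw [Matrix.map_apply, Matrix.add_apply, Matrix.smul_apply, Matrix.map_apply, smul_eq_mul] at h1
    have hone : ((1 : Matrix (Fin 3) (Fin 3) ℂ) i j) = ((1 : Matrix (Fin 3) (Fin 3) ℤ) i j : ℤ) := by
      rw [Matrix.one_apply, Matrix.one_apply]; split_ifs <;> simp
    -- `A` is real, so the entries of `E` are too. Twice such an entry is its trace, an integer, and
    -- the factor 2 in `m` supplies this doubling.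
    have hreal : conj (s (E i j)) = s (E i j) := by
      have h2 := congrArg conj h1
      rw [map_add, map_mul, hone, Complex.ofRealHom_eq_coe, Complex.conj_ofReal,
        map_intCast, map_intCast, ← hone, ← Complex.ofRealHom_eq_coe, h1] at h2
      exact (mul_left_cancel₀ hmc (add_left_cancel h2)).symm
    have h3 := ht (E i j)
    rw [hreal] at h3
    rw [← Complex.ofRealHom_eq_coe, h1, Matrix.map_apply, Matrix.add_apply, Matrix.smul_apply,
      show E' i j = t (E i j) from rfl, hone]
    simp only [m]
    push_cast
    simp
    linear_combination (16 * a * b : ℂ) * h3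
  have hGc : pureGram (a : ℝ) b = (pureGram a b).map (Int.castRingHom ℝ) := by
    rw [pureGram_map]; rfl
  have hinj : Function.Injective fun M : Matrix (Fin 3) (Fin 3) ℤ => M.map (Int.castRingHom ℝ) :=
    Matrix.map_injective (RingHom.injective_int (Int.castRingHom ℝ))
  obtain ⟨q, hq1, hq⟩ := exists_conjMatrix_eq_of_congruence ha hb E'
    (hinj (by
      simp only [Matrix.map_mul, Matrix.transpose_map, ← hGc, ← hAE', hA]))
    (by
      have h1 : ((1 + (16 * a * b) • E').det : ℝ) = (A : Matrix (Fin 3) (Fin 3) ℝ).det := by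
        rw [hAE', ← RingHom.mapMatrix_apply, ← RingHom.map_det]; rfl
      have h2 : ((A : Matrix (Fin 3) (Fin 3) ℝ).det : ℂ) = 1 := by
        have h3 : (Matrix.GeneralLinearGroup.map s X : Matrix (Fin 3) (Fin 3) ℂ).det = 1 := by
          rw [coe_GL_map, ← RingHom.mapMatrix_apply, ← RingHom.map_det, hdet, map_one]
        rw [← hAX, ← Matrix.GeneralLinearGroup.val_det_apply] at h3
        simp only [map_mul, map_inv, mul_inv_cancel_comm] at h3
        rw [Matrix.GeneralLinearGroup.val_det_apply, coe_GL_map] at h3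
        rw [← h3]
        exact RingHom.map_det Complex.ofRealHom _
      have h4 : (A : Matrix (Fin 3) (Fin 3) ℝ).det = 1 := by exact_mod_cast h2
      rw [h4] at h1
      exact_mod_cast h1)
  refine ⟨⟨q, mem_unitary_iff_reducedNorm.mpr hq1⟩, trivial, ?_⟩
  have hAq : Matrix.GeneralLinearGroup.map (Int.castRingHom ℝ)
      (conjGL a b ⟨q, mem_unitary_iff_reducedNorm.mpr hq1⟩) = A := by
    apply Units.ext
    rw [coe_GL_map, coe_conjGL, hAE', hq]
  change frameHom P (Matrix.GeneralLinearGroup.map (Int.castRingHom ℝ) _) = _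
  rw [hAq, frameHom_apply, hAX]
  rfl

end Commensurable

/-! ### Integral frames for `Y_Δ` and the two cases of the theorem -/

section PicardStabilizer

variable {K : Type*} [Field K] [NumberField K] [NumberField.IsTotallyComplex K]

/-- An integral basis of the form `P = [i ↦ _, j ↦ _, k ↦ _]` of the real points of `z ↦ Y_Δ z̄`
on which `h` is a multiple of the square form of `(a, b)` shows that the stabiliser of `[Y_Δ]` arises
from `(a, b)`. -/
theorem arisesFrom_of_frame (hK : Module.finrank ℚ K = 2) (σ : K →+* ℂ) (Δ : 𝓞 K) (hΔ : Δ ≠ 0)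
    {a b : ℤ} (ha : a ≠ 0) (hb : 0 < b) {c : ℝ} (hc : 0 < c) (Q : Matrix (Fin 3) (Fin 3) (𝓞 K))
    (hQ : (Q.map (σ.comp (algebraMap (𝓞 K) K)))ᴴ * hermMatrix *
      Q.map (σ.comp (algebraMap (𝓞 K) K)) =
        (c : ℂ) • (pureGram (a : ℝ) b).map Complex.ofRealHom)
    (hYQ : (YMatrix (σ (Δ : K)) (by simpa using hΔ) : Matrix (Fin 3) (Fin 3) ℂ) *
      (Q.map (σ.comp (algebraMap (𝓞 K) K))).map (starRingEnd ℂ) =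
        Q.map (σ.comp (algebraMap (𝓞 K) K))) :
    ArisesFrom (picardStabilizer K σ Δ hΔ) a b := by
  have ha' : (a : ℝ) ≠ 0 := by exact_mod_cast ha
  have hb' : (0 : ℝ) < b := by exact_mod_cast hb
  have hN : ∀ w : 𝓞 K, ∃ n : ℤ, (σ.comp (algebraMap (𝓞 K) K)) w *
      conj ((σ.comp (algebraMap (𝓞 K) K)) w) = n := fun w => ⟨_, (norm_eq_mul_conj hK σ w).symm⟩
  have hT : ∀ w : 𝓞 K, ∃ n : ℤ, (σ.comp (algebraMap (𝓞 K) K)) w +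
      conj ((σ.comp (algebraMap (𝓞 K) K)) w) = n := fun w => ⟨_, (trace_eq_add_conj hK σ w).symm⟩
  have hs : Function.Injective (σ.comp (algebraMap (𝓞 K) K)) :=
    σ.injective.comp (FaithfulSMul.algebraMap_injective (𝓞 K) K)
  have hdet : (Q.map (σ.comp (algebraMap (𝓞 K) K))).det ≠ 0 := fun h0 => by
    have h := congrArg Matrix.det hQ
    rw [Matrix.det_mul, h0, mul_zero, Matrix.det_smul, ← RingHom.mapMatrix_apply,
      ← RingHom.map_det] at h
    have hG : (pureGram (a : ℝ) b).det ≠ 0 := by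
      simp [Matrix.det_fin_three, pureGram, ha, hb.ne']
    refine mul_ne_zero (pow_ne_zero _ ?_) ?_ h.symm
    · exact_mod_cast hc.ne'
    · exact Complex.ofReal_ne_zero.mpr hG
  obtain ⟨P, hPQ⟩ : ∃ P : GL (Fin 3) ℂ, (P : Matrix (Fin 3) (Fin 3) ℂ) =
      Q.map (σ.comp (algebraMap (𝓞 K) K)) := ⟨.mkOfDetNeZero _ hdet, rfl⟩
  have hY : YMatrix (σ (Δ : K)) (by simpa using hΔ) *
      Matrix.GeneralLinearGroup.map (starRingEnd ℂ) P = P :=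
    Units.ext (by rw [Units.val_mul, coe_GL_map, hPQ, hYQ])
  rw [← hPQ] at hQ
  obtain ⟨T, hTG⟩ := exists_isometry_pureGram ha' hb'
  have hH := mem_conjPO12_iff (P := P) hTG
  refine ⟨⟨algEquivMatrix ha' hb'⟩, _, similitude_frame_mem_PU12 hc hQ hTG, fun x hx => ?_,
    (frameHom P).comp (conjGL (a : ℝ) (b : ℝ)), ?_, ?_, ?_, ?_, ?_⟩
  · obtain ⟨⟨hxU, -⟩, hxY⟩ := hx
    obtain ⟨X, hX, rfl, hXY⟩ := exists_representative_of_twisted (YMatrix_mem_U12 _ _) hxU hxY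
    obtain ⟨A, hA, hAX⟩ := exists_real_of_twisted hc hQ hY hX hXY
    exact (hH _).mpr ⟨A, hA, by rw [frameHom_apply, hAX]⟩
  · exact (continuous_frameHom P).comp continuous_conjGL
  · exact range_frameHom_conjGL_eq_identityComponent ha' hb' P _ hH
  · exact ker_frameHom_conjGL ha' hb' P
  · exact relIndex_integral_ne_zero hN hT hs hc hPQ hQ hY
  · refine relIndex_stabilizer_ne_zero hN hT hs ha hb.ne' hc hPQ hQ hY (fun j => ?_) (fun i => ?_)
    · fin_cases j <;> simp [YMatrix, Matrix.one_apply]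
    · fin_cases i <;> simp [YMatrix, Matrix.one_apply]

theorem arisesFrom_of_trace_ne_zero (hK : Module.finrank ℚ K = 2) (σ : K →+* ℂ) (Δ : 𝓞 K)
    (hΔ : Δ ≠ 0) (htr : Algebra.trace ℤ (𝓞 K) Δ ≠ 0) :
    ArisesFrom (picardStabilizer K σ Δ hΔ) (2 * Algebra.trace ℤ (𝓞 K) Δ)
      (Algebra.norm ℤ Δ * |NumberField.discr K|) := by
  obtain ⟨δ, hδ, hδ2⟩ := exists_sq_eq_discr hK σ
  have hD := discr_neg hK σ
  set b : ℤ := Algebra.norm ℤ Δ * |NumberField.discr K| with hbdef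
  have hb : 0 < b := mul_pos (norm_pos_of_ne_zero hK σ hΔ) (abs_pos.mpr hD.ne)
  have hbc : (b : ℂ) = -(σ Δ * conj (σ Δ) * σ δ ^ 2) := by
    rw [hbdef, abs_of_neg hD]
    push_cast
    rw [norm_eq_mul_conj hK σ, hδ2]
    ring
  have htc := trace_eq_add_conj hK σ Δ
  have hnc := norm_eq_mul_conj hK σ Δ
  have hne : conj (σ (Δ : K)) ≠ 0 := by simpa using hΔ
  -- In the form `-Re(Δ̄ z₀²) + t²` on the fixed vectors `(z₀, t, Δ z̄₀)`, the choices `z₀ = 2Δδ`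
  -- and `z₀ = 2b` are orthogonal because `δ` is purely imaginary. Their values are `ab` and `-ab²`,
  -- and `t = b` gives `b²`, which is `b` times `(a, -ab, b)`.
  refine arisesFrom_of_frame hK σ Δ hΔ (mul_ne_zero two_ne_zero htr) hb (c := b)
    (by exact_mod_cast hb) !![2 * Δ * δ, 0, (2 * b : 𝓞 K); 0, (b : 𝓞 K), 0;
      -(2 * (Algebra.norm ℤ Δ : ℤ) * δ : 𝓞 K), 0, 2 * b * Δ] ?_ ?_
  · ext i j
    fin_cases i <;> fin_cases j <;>
      simp [Matrix.mul_apply, Fin.sum_univ_three, hermMatrix, pureGram, map_ofNat, htc, hnc, hbc, hδ,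
        -mul_eq_mul_left_iff, -mul_eq_mul_right_iff]
        <;> ring
  · ext i j
    fin_cases i <;> fin_cases j <;>
      simp [Matrix.mul_apply, Fin.sum_univ_three, YMatrix, map_ofNat, hnc, hδ] <;> field_simp

theorem arisesFrom_of_trace_eq_zero (hK : Module.finrank ℚ K = 2) (σ : K →+* ℂ) (Δ : 𝓞 K)
    (hΔ : Δ ≠ 0) (htr : Algebra.trace ℤ (𝓞 K) Δ = 0) :
    ArisesFrom (picardStabilizer K σ Δ hΔ) 1 1 := by
  have hn := norm_pos_of_ne_zero hK σ hΔ
  have htc := trace_eq_add_conj hK σ Δ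
  rw [htr, Int.cast_zero] at htc
  have hconj : conj (σ (Δ : K)) = -σ Δ := by linear_combination -htc
  have hnc := norm_eq_mul_conj hK σ Δ
  rw [hconj] at hnc
  have hne : σ (Δ : K) ≠ 0 := by simpa using hΔ
  set n : ℤ := Algebra.norm ℤ Δ
  -- Now `Δ` is purely imaginary, and for `z₀ = x + yΔ` the form is `-2nxy + t²` with a rational
  -- hyperbolic plane. Taking `x = ∓2n`, `y = 1` and `t = 2n` gives the values `4n²`, `-4n²` and
  -- `4n²`.
  refine arisesFrom_of_frame hK σ Δ hΔ one_ne_zero one_pos (c := 4 * n ^ 2) (by positivity)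
    !![-(2 * n) + Δ, 0, (2 * n : 𝓞 K) + Δ; 0, (2 * n : 𝓞 K), 0;
      -(2 * n) * Δ + n, 0, (2 * n : 𝓞 K) * Δ + n] ?_ ?_
  · ext i j
    fin_cases i <;> fin_cases j <;>
      simp [Matrix.mul_apply, Fin.sum_univ_three, hermMatrix, pureGram, map_ofNat, hconj, hnc]
        <;> ring
  · ext i j
    fin_cases i <;> fin_cases j <;>
      simp [Matrix.mul_apply, Fin.sum_univ_three, YMatrix, map_ofNat, hconj, hnc] <;> field_simp
        <;> ring

end PicardStabilizer

theorem theorem1p2 (K : Type*) [Field K] [NumberField K] [NumberField.IsTotallyComplex K]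
    (hK : Module.finrank ℚ K = 2) (σ : K →+* ℂ) (Δ : 𝓞 K) (hΔ : Δ ≠ 0) :
    (Algebra.trace ℤ (𝓞 K) Δ ≠ 0 →
      ArisesFrom (picardStabilizer K σ Δ hΔ)
        (2 * Algebra.trace ℤ (𝓞 K) Δ) (Algebra.norm ℤ Δ * |NumberField.discr K|)) ∧
    (Algebra.trace ℤ (𝓞 K) Δ = 0 →
      ArisesFrom (picardStabilizer K σ Δ hΔ) 1 1 ∧
      Nonempty (ℍ[ℚ, 1, 0, 1] ≃ₐ[ℚ] Matrix (Fin 2) (Fin 2) ℚ)) := by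
  exact ⟨arisesFrom_of_trace_ne_zero hK σ Δ hΔ,
    fun h => ⟨arisesFrom_of_trace_eq_zero hK σ Δ hΔ h,
      ⟨algEquivMatrixOfSq one_ne_zero one_ne_zero (one_pow 2)⟩⟩⟩
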